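/- Let $n\ge 1$ and let $w:\mathbb R^n\to[0,\infty)$ be a measurable radial function. Let $\mathcal B(\mathbb C^n,w)$ be the weighted Bergman space of all entire functions $F$ on $\mathbb C^n$ with $$\int_{\mathbb R^n}\int_{\mathbb R^n}|F(x+iy)|^2\,w(y)\,dx\,dy<\infty .$$ Let $q\in L^1(\mathbb R^n)$ (complex valued) be such that the image of $L^2(\mathbb R^n)$ under the transform $T_qf(z)=f*q(z)$ is $\mathcal B(\mathbb C^n,w)$; that is, for every $f\in L^2(\mathbb R^n)$ the convolution $f*q$ agrees almost everywhere on $\mathbb R^n$ with the restriction of a (necessarily unique) entire function $T_qf\in\mathcal B(\mathbb C^n,w)$, and every element of $\mathcal B(\mathbb C^n,w)$ is of the form $T_qf$ with $f\in L^2(\mathbb R^n)$. Then $q*q$ also extends to an entire function on $\mathbb C^n$. Assume that its values $q*q(2iy)$, $y\in\mathbb R^n$, are real and nonnegative, so that $\sqrt{q*q(2iy)}$ makes sense. If $f\in L^2(\mathbb R^n)$ satisfies $$\int_{\mathbb R^n}|f*q(y)|\,\sqrt{q*q(2iy)}\,dy<\infty ,$$ then $f*q=0$ almost everywhere. Consequently,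 if $T_q$ is injective on $L^2(\mathbb R^n)$ (for instance if $\int_{\mathbb C^n}|T_qf(z)|^2w(y)\,dz=c\int_{\mathbb R^n}|f(x)|^2dx$ for all $f\in L^2(\mathbb R^n)$ and some constant $c>0$), there is no nontrivial $f\in L^2(\mathbb R^n)$ satisfying this condition. -/

import Mathlib

open MeasureTheory
open scoped ENNReal NNReal

noncomputable section

/-- The point `x + i y` of `ℂⁿ`, for `x, y` in `ℝⁿ`. -/
def complexPoint {n : ℕ} (x y : EuclideanSpace ℝ (Fin n)) : EuclideanSpace ℂ (Fin n) :=
  WithLp.toLp 2 fun j => (x j : ℂ) + (y j : ℂ) * Complex.I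

/-- The convolution `(f * q)(x) = ∫ f(t) q(x - t) dt` on `ℝⁿ`. -/
def fconv {n : ℕ} (f q : EuclideanSpace ℝ (Fin n) → ℂ) : EuclideanSpace ℝ (Fin n) → ℂ :=
  MeasureTheory.convolution f q (ContinuousLinearMap.mul ℂ ℂ) volume

/-- `G` is an entire function on `ℂⁿ` whose restriction to `ℝⁿ` is (a.e. equal to) `g`.
Such a `G` is unique; its value at `z` is what is meant by `g(z)`. -/
def IsEntireExtension {n : ℕ} (g : EuclideanSpace ℝ (Fin n) → ℂ)
    (G : EuclideanSpace ℂ (Fin n) → ℂ) : Prop :=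
  Differentiable ℂ G ∧ ∀ᵐ x : EuclideanSpace ℝ (Fin n), G (complexPoint x 0) = g x

/-- The weighted Bergman space `B(ℂⁿ, w)`: entire functions `F` with
`∫ |F(x + i y)|² w(y) dx dy < ∞`. -/
def weightedBergman {n : ℕ} (w : EuclideanSpace ℝ (Fin n) → ℝ≥0) :
    Set (EuclideanSpace ℂ (Fin n) → ℂ) :=
  {F | Differentiable ℂ F ∧
    ∫⁻ p : EuclideanSpace ℝ (Fin n) × EuclideanSpace ℝ (Fin n),
      ‖F (complexPoint p.1 p.2)‖ₑ ^ 2 * (w p.2 : ℝ≥0∞) < ∞}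

/-- `f ↦ f * q(z)` maps `L²(ℝⁿ)` into and onto `B(ℂⁿ, w)`. -/
def ImageIsBergman {n : ℕ} (q : EuclideanSpace ℝ (Fin n) → ℂ)
    (w : EuclideanSpace ℝ (Fin n) → ℝ≥0) : Prop :=
  (∀ f : EuclideanSpace ℝ (Fin n) → ℂ, MemLp f 2 volume →
    ∃ F ∈ weightedBergman w, IsEntireExtension (fconv f q) F) ∧
  (∀ F ∈ weightedBergman w,
    ∃ f : EuclideanSpace ℝ (Fin n) → ℂ, MemLp f 2 volume ∧ IsEntireExtension (fconv f q) F)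

/-- `f ↦ f * q` is injective on `L²(ℝⁿ)`. -/
def TransformInjective {n : ℕ} (q : EuclideanSpace ℝ (Fin n) → ℂ) : Prop :=
  ∀ f g : EuclideanSpace ℝ (Fin n) → ℂ, MemLp f 2 volume → MemLp g 2 volume →
    fconv f q =ᵐ[volume] fconv g q → f =ᵐ[volume] g

end

/-!
On the Fourier side `T_q f` is the Fourier–Laplace integral of `𝓕 f · 𝓕 q`, because point
evaluations `f ↦ T_q f(z)` are continuous on `L²`; in particular every `𝓕 q · e^{-2π y·ξ}` is square
integrable.
That the image is the whole Bergman space forces `{𝓕 q ≠ 0}` to be the interior of the convex domain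
of finiteness of the Laplace transform of `w`, hence connected, and gives `|𝓕 q(-ξ)| ≤ C |𝓕 q(ξ)|`.
Nonnegativity of `q * q (2iy)` and connectedness then make `(𝓕 q)²` nonnegative, so that
`q * q (2iy)` is the energy `E(y) = ∫ |𝓕 q(ξ) e^{-2π y·ξ}|² dξ`, and Cauchy–Schwarz bounds
`F = T_q f` by `|F(x + iby)| ≤ A √(E(y))` for `|b| ≤ 1`.

The hypothesis on `f` thus makes the correlation `Φ(ζ) = ∫ F(ζx) conj(F(x)) dx` a bounded
holomorphic function on the strip `|Im ζ| < 1`. On the real line `Φ(1/t) = |t|ⁿ conj(Φ(t))`, which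
extends `Φ²` by reflection to a bounded entire function tending to `0`. By Liouville it vanishes,
and `∫ |F|² = Φ(1) = 0`.
-/

local notation "ℝ^" n:max => EuclideanSpace ℝ (Fin n)
local notation "ℂ^" n:max => EuclideanSpace ℂ (Fin n)

section FourierPreliminaries

open FourierTransform SchwartzMap

theorem integrable_of_locallyIntegrable_of_hasCompactSupport {X E : Type*} [TopologicalSpace X]
    [MeasurableSpace X] [NormedAddCommGroup E] {μ : Measure X} {f : X → E}
    (hf : LocallyIntegrable f μ) (hf' : HasCompactSupport f) : Integrable f μ :=
  (integrableOn_iff_integrable_of_support_subset (subset_tsupport f)).1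
    (hf.integrableOn_isCompact hf')

theorem integrable_continuous_smul_of_hasCompactSupport {X 𝕜 E : Type*} [TopologicalSpace X]
    [T2Space X] [MeasurableSpace X] [OpensMeasurableSpace X] [NormedField 𝕜]
    [NormedAddCommGroup E] [NormedSpace 𝕜 E] [SecondCountableTopologyEither X 𝕜] {μ : Measure X}
    {g : X → 𝕜} {f : X → E} (hg : Continuous g) (hf : LocallyIntegrable f μ)
    (hf' : HasCompactSupport f) : Integrable (fun x => g x • f x) μ :=
  (integrableOn_iff_integrable_of_support_subset
    ((Function.support_smul_subset_right g f).trans (subset_tsupport f))).1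
    ((hf.integrableOn_isCompact hf').continuousOn_smul hg.continuousOn hf')

variable {V : Type*} [NormedAddCommGroup V] [InnerProductSpace ℝ V] [FiniteDimensional ℝ V]
  [MeasurableSpace V] [BorelSpace V]

theorem ae_eq_of_forall_integral_schwartz_mul_eq {f g : V → ℂ} (hf : LocallyIntegrable f volume)
    (hg : LocallyIntegrable g volume)
    (h : ∀ ψ : 𝓢(V, ℂ), ∫ x, ψ x * f x = ∫ x, ψ x * g x) : f =ᵐ[volume] g := by
  refine ae_eq_of_integral_contDiff_smul_eq hf hg fun u hu hu' => ?_
  have hsupp : HasCompactSupport (Complex.ofRealCLM ∘ u) := hu'.comp_left rfl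
  have hdiff : ContDiff ℝ ((⊤ : ℕ∞) : WithTop ℕ∞) (Complex.ofRealCLM ∘ u) := by fun_prop
  simpa using h (hsupp.toSchwartzMap hdiff)

theorem integral_fourier_mul_eq_flip {f g : V → ℂ} (hf : Integrable f volume)
    (hg : Integrable g volume) : ∫ x, 𝓕 f x * g x = ∫ x, f x * 𝓕 g x := by
  have h := VectorFourier.integral_fourierIntegral_smul_eq_flip (μ := (volume : Measure V))
    (ν := (volume : Measure V)) (L := innerₗ V) Real.continuous_fourierChar
    (by simpa using continuous_inner) hf hg
  simp only [flip_innerₗ, smul_eq_mul] at h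
  exact h

theorem integral_fourierInv_mul_eq_flip {f g : V → ℂ} (hf : Integrable f volume)
    (hg : Integrable g volume) : ∫ x, 𝓕⁻ f x * g x = ∫ x, f x * 𝓕⁻ g x := by
  simp_rw [Real.fourierInv_eq_fourier_comp_neg]
  rw [integral_fourier_mul_eq_flip hf.comp_neg hg, ← integral_neg_eq_self]
  simp [← Real.fourierInv_eq_fourier_comp_neg, Real.fourierInv_eq_fourier_neg]

theorem integral_schwartz_mul_eq_integral_fourier_mul_fourierInv {f : V → ℂ}
    (hf : Integrable f volume) (ψ : 𝓢(V, ℂ)) :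
    ∫ x, ψ x * f x = ∫ x, 𝓕 ψ x * 𝓕⁻ f x := by
  rw [← integral_fourierInv_mul_eq_flip ((𝓕 ψ).integrable (μ := volume)) hf,
    ← SchwartzMap.fourierInv_coe, FourierTransform.fourierInv_fourier_eq]

theorem ae_eq_of_fourierInv_eq {f g : V → ℂ} (hf : Integrable f volume)
    (hg : Integrable g volume) (h : 𝓕⁻ f = 𝓕⁻ g) : f =ᵐ[volume] g := by
  refine ae_eq_of_forall_integral_schwartz_mul_eq hf.locallyIntegrable hg.locallyIntegrable
    fun ψ => ?_
  rw [integral_schwartz_mul_eq_integral_fourier_mul_fourierInv hf,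
    integral_schwartz_mul_eq_integral_fourier_mul_fourierInv hg, h]

theorem continuous_fourier_of_integrable {f : V → ℂ} (hf : Integrable f volume) :
    Continuous (𝓕 f) :=
  VectorFourier.fourierIntegral_continuous Real.continuous_fourierChar
    (by simpa using continuous_inner) hf

theorem continuous_fourierInv_of_integrable {f : V → ℂ} (hf : Integrable f volume) :
    Continuous (𝓕⁻ f) := by
  rw [Real.fourierInv_eq_fourier_comp_neg]
  exact continuous_fourier_of_integrable hf.comp_neg

theorem locallyIntegrable_coeFn_Lp_two (φ : Lp ℂ 2 (volume : Measure V)) :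
    LocallyIntegrable φ volume :=
  (Lp.memLp φ).locallyIntegrable one_le_two

theorem integral_schwartz_mul_fourierInv_toLp {φ : V → ℂ} (hφ : MemLp φ 2 volume) (ψ : 𝓢(V, ℂ)) :
    ∫ x, ψ x * (𝓕⁻ (hφ.toLp φ) : Lp ℂ 2 (volume : Measure V)) x = ∫ x, (𝓕⁻ ψ) x * φ x := by
  have h := congrArg (fun T : 𝓢'(V, ℂ) => T ψ)
    (Lp.fourierInv_toTemperedDistribution_eq (hφ.toLp φ))
  have h' : ∫ x, ψ x * (𝓕⁻ (hφ.toLp φ) : Lp ℂ 2 (volume : Measure V)) x =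
      ∫ x, (𝓕⁻ ψ) x * hφ.toLp φ x := by simpa using h.symm
  rw [h']
  refine integral_congr_ae ?_
  filter_upwards [hφ.coeFn_toLp] with x hx
  rw [hx]

theorem fourierInv_toLp_ae_eq {φ : V → ℂ} (hφ : Integrable φ volume) (hφ' : MemLp φ 2 volume) :
    (𝓕⁻ (hφ'.toLp φ) : Lp ℂ 2 (volume : Measure V)) =ᵐ[volume] 𝓕⁻ φ := by
  refine ae_eq_of_forall_integral_schwartz_mul_eq (locallyIntegrable_coeFn_Lp_two _)
    (continuous_fourierInv_of_integrable hφ).locallyIntegrable fun ψ => ?_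
  rw [integral_schwartz_mul_fourierInv_toLp, SchwartzMap.fourierInv_coe,
    integral_fourierInv_mul_eq_flip (ψ.integrable (μ := volume)) hφ]

theorem fourierInv_toLp_fourier_ae_eq {q : V → ℂ} (hq : Integrable q volume)
    (hq' : MemLp (𝓕 q) 2 volume) :
    (𝓕⁻ (hq'.toLp (𝓕 q)) : Lp ℂ 2 (volume : Measure V)) =ᵐ[volume] q := by
  refine ae_eq_of_forall_integral_schwartz_mul_eq (locallyIntegrable_coeFn_Lp_two _)
    hq.locallyIntegrable fun ψ => ?_
  rw [integral_schwartz_mul_fourierInv_toLp,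
    ← integral_fourier_mul_eq_flip ((𝓕⁻ ψ).integrable (μ := volume)) hq,
    ← SchwartzMap.fourier_coe, FourierTransform.fourier_fourierInv_eq]

end FourierPreliminaries

section ComplexPoint

open Complex Filter Topology

variable {n : ℕ}

theorem complexPoint_apply (x y : ℝ^n) (j : Fin n) :
    complexPoint x y j = (x j : ℂ) + (y j : ℂ) * I := rfl

@[simp]
theorem complexPoint_zero_zero : complexPoint (0 : ℝ^n) 0 = 0 := by
  ext j
  simp [complexPoint_apply]

theorem exists_complexPoint_eq (z : ℂ^n) : ∃ x y : ℝ^n, complexPoint x y = z := by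
  refine ⟨WithLp.toLp 2 fun j => (z j).re, WithLp.toLp 2 fun j => (z j).im, ?_⟩
  ext j
  simp [complexPoint_apply, re_add_im]

theorem complexPoint_add (x x' y y' : ℝ^n) :
    complexPoint (x + x') (y + y') = complexPoint x y + complexPoint x' y' := by
  ext j
  simp only [complexPoint_apply, PiLp.add_apply, ofReal_add]
  ring

theorem complexPoint_eq_add (x y : ℝ^n) :
    complexPoint x y = complexPoint 0 y + complexPoint x 0 := by
  rw [← complexPoint_add, zero_add, add_zero]

theorem neg_complexPoint (x y : ℝ^n) : -complexPoint x y = complexPoint (-x) (-y) := by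
  ext j
  simp only [complexPoint_apply, PiLp.neg_apply, ofReal_neg]
  ring

theorem smul_complexPoint_zero_right (ζ : ℂ) (x : ℝ^n) :
    ζ • complexPoint x 0 = complexPoint (ζ.re • x) (ζ.im • x) := by
  ext j
  apply Complex.ext <;> simp [complexPoint_apply]

theorem continuous_complexPoint :
    Continuous fun p : ℝ^n × ℝ^n => complexPoint p.1 p.2 := by
  unfold complexPoint
  fun_prop

theorem continuous_complexPoint_zero_right : Continuous fun x : ℝ^n => complexPoint x 0 :=
  continuous_complexPoint.comp (by fun_prop : Continuous fun x : ℝ^n => (x, (0 : ℝ^n)))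

theorem norm_complexPoint_zero_right (x : ℝ^n) : ‖complexPoint x 0‖ = ‖x‖ := by
  simp [EuclideanSpace.norm_eq, complexPoint_apply]

/-- The complexification `ζ ↦ x + ζ y` of the real line through `x` with direction `y`. -/
def complexLine (x y : ℝ^n) (ζ : ℂ) : ℂ^n := complexPoint x 0 + ζ • complexPoint y 0

theorem complexLine_eq_complexPoint (x y : ℝ^n) (ζ : ℂ) :
    complexLine x y ζ = complexPoint (x + ζ.re • y) (ζ.im • y) := by
  rw [complexLine, smul_complexPoint_zero_right, ← complexPoint_add, zero_add]

theorem complexLine_ofReal (x y : ℝ^n) (t : ℝ) :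
    complexLine x y t = complexPoint (x + t • y) 0 := by
  simp [complexLine_eq_complexPoint]

theorem complexLine_I (x y : ℝ^n) : complexLine x y I = complexPoint x y := by
  simp [complexLine_eq_complexPoint]

theorem differentiable_complexLine (x y : ℝ^n) : Differentiable ℂ (complexLine x y) := by
  unfold complexLine
  fun_prop

theorem eqOn_of_forall_ofReal_eq {U : Set ℂ} (hU : IsOpen U) (hU' : IsPreconnected U) {t₀ : ℝ}
    (ht₀ : (t₀ : ℂ) ∈ U) {f g : ℂ → ℂ} (hf : DifferentiableOn ℂ f U) (hg : DifferentiableOn ℂ g U)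
    (h : ∀ t : ℝ, (t : ℂ) ∈ U → f t = g t) : Set.EqOn f g U := by
  have hreal : Tendsto Complex.ofReal (𝓝[≠] t₀) (𝓝[≠] (t₀ : ℂ)) :=
    tendsto_nhdsWithin_iff.2 ⟨(Complex.continuous_ofReal.tendsto t₀).mono_left nhdsWithin_le_nhds,
      by filter_upwards [self_mem_nhdsWithin] with t ht; simpa using ht⟩
  have hmem : ∀ᶠ t : ℝ in 𝓝[≠] t₀, (t : ℂ) ∈ U :=
    hreal.eventually (nhdsWithin_le_nhds (hU.mem_nhds ht₀))
  exact (hf.analyticOnNhd hU).eqOn_of_preconnected_of_frequently_eq (hg.analyticOnNhd hU) hU' ht₀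
    (hreal.frequently (hmem.mono h).frequently)

theorem eq_of_forall_ofReal_eq {f g : ℂ → ℂ} (hf : Differentiable ℂ f) (hg : Differentiable ℂ g)
    (h : ∀ t : ℝ, f t = g t) : f = g :=
  Set.eqOn_univ f g |>.1 (eqOn_of_forall_ofReal_eq isOpen_univ isPreconnected_univ (t₀ := 0)
    (Set.mem_univ _) hf.differentiableOn hg.differentiableOn fun t _ => h t)

namespace IsEntireExtension

variable {g : ℝ^n → ℂ} {F G : ℂ^n → ℂ}

theorem unique (hF : IsEntireExtension g F) (hG : IsEntireExtension g G) : F = G := by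
  have hreal : (fun x => F (complexPoint x 0)) = fun x => G (complexPoint x 0) := by
    refine (Continuous.ae_eq_iff_eq volume
      (hF.1.continuous.comp continuous_complexPoint_zero_right)
      (hG.1.continuous.comp continuous_complexPoint_zero_right)).1 ?_
    filter_upwards [hF.2, hG.2] with x hx hx'
    rw [Function.comp_apply, Function.comp_apply, hx, hx']
  funext z
  obtain ⟨x, y, rfl⟩ := exists_complexPoint_eq z
  rw [← complexLine_I]
  refine congrFun (eq_of_forall_ofReal_eq (hF.1.comp (differentiable_complexLine x y))
    (hG.1.comp (differentiable_complexLine x y)) fun t => ?_) I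
  simpa only [Function.comp_apply, complexLine_ofReal] using congrFun hreal (x + t • y)

end IsEntireExtension

end ComplexPoint

section FourierLaplace

open Complex FourierTransform RealInnerProductSpace

variable {n : ℕ}

/-- The complex bilinear pairing `z ↦ ∑ ξⱼ zⱼ` with a real vector `ξ`. -/
noncomputable def complexDot (ξ : ℝ^n) : ℂ^n →L[ℂ] ℂ := innerSL ℂ (complexPoint ξ 0)

theorem norm_complexDot (ξ : ℝ^n) : ‖complexDot ξ‖ = ‖ξ‖ := by
  rw [complexDot, innerSL_apply_norm, norm_complexPoint_zero_right]

theorem continuous_complexDot : Continuous fun ξ : ℝ^n => complexDot ξ :=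
  (innerSL ℂ).continuous.comp continuous_complexPoint_zero_right

theorem complexDot_complexPoint (ξ x y : ℝ^n) :
    complexDot ξ (complexPoint x y) = (⟪ξ, x⟫ : ℂ) + (⟪ξ, y⟫ : ℂ) * I := by
  simp only [complexDot, innerSL_apply_apply, PiLp.inner_apply, complexPoint_apply, ofReal_sum,
    Finset.sum_mul, ← Finset.sum_add_distrib]
  refine Finset.sum_congr rfl fun j _ => ?_
  simp
  ring

/-- The plane wave `exp (2πi ∑ ξⱼ zⱼ)` of real frequency `ξ`, as a function on `ℂⁿ`. -/
noncomputable def planeWave (ξ : ℝ^n) (z : ℂ^n) : ℂ := cexp (2 * Real.pi * I * complexDot ξ z)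

theorem continuous_planeWave_left (z : ℂ^n) : Continuous fun ξ => planeWave ξ z := by
  have := continuous_complexDot (n := n)
  unfold planeWave
  fun_prop

theorem planeWave_add (ξ : ℝ^n) (z z' : ℂ^n) :
    planeWave ξ (z + z') = planeWave ξ z * planeWave ξ z' := by
  simp only [planeWave, map_add, mul_add, Complex.exp_add]

theorem planeWave_complexPoint_zero_right (ξ x : ℝ^n) :
    planeWave ξ (complexPoint x 0) = cexp (↑(2 * Real.pi * ⟪ξ, x⟫) * I) := by
  rw [planeWave, complexDot_complexPoint]
  congr 1
  push_cast
  simp only [inner_zero_right, ofReal_zero]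
  ring

theorem norm_planeWave (ξ x y : ℝ^n) :
    ‖planeWave ξ (complexPoint x y)‖ = Real.exp (-(2 * Real.pi * ⟪ξ, y⟫)) := by
  rw [planeWave, complexDot_complexPoint, Complex.norm_exp]
  congr 1
  simp

theorem norm_two_pi_I : ‖(2 * Real.pi * I : ℂ)‖ = 2 * Real.pi := by
  simp [abs_of_pos Real.pi_pos]

theorem norm_planeWave_le (ξ : ℝ^n) (z : ℂ^n) :
    ‖planeWave ξ z‖ ≤ Real.exp (2 * Real.pi * ‖z‖ * ‖ξ‖) := by
  rw [planeWave, Complex.norm_exp, Real.exp_le_exp]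
  calc (2 * Real.pi * I * complexDot ξ z).re
      ≤ ‖2 * Real.pi * I * complexDot ξ z‖ := Complex.re_le_norm _
    _ = 2 * Real.pi * ‖complexDot ξ z‖ := by rw [norm_mul, norm_two_pi_I]
    _ ≤ 2 * Real.pi * (‖ξ‖ * ‖z‖) := by
        gcongr
        simpa only [norm_complexDot] using (complexDot ξ).le_opNorm z
    _ = 2 * Real.pi * ‖z‖ * ‖ξ‖ := by ring

theorem hasFDerivAt_planeWave (ξ : ℝ^n) (z : ℂ^n) :
    HasFDerivAt (planeWave ξ) (planeWave ξ z • (2 * Real.pi * I : ℂ) • complexDot ξ) z :=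
  ((complexDot ξ).hasFDerivAt.const_mul _).cexp

/-- The Fourier–Laplace transform `z ↦ ∫ h(ξ) exp (2πi ∑ ξⱼ zⱼ) dξ`, which extends the inverse
Fourier transform of `h` to `ℂⁿ`. -/
noncomputable def fourierLaplace (h : ℝ^n → ℂ) (z : ℂ^n) : ℂ := ∫ ξ, h ξ * planeWave ξ z

theorem fourierLaplace_mul_congr_left {φ ψ : ℝ^n → ℂ} (hφψ : φ =ᵐ[volume] ψ) (h : ℝ^n → ℂ) :
    (fourierLaplace fun ξ => φ ξ * h ξ) = fourierLaplace fun ξ => ψ ξ * h ξ := by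
  funext z
  refine integral_congr_ae ?_
  filter_upwards [hφψ] with ξ hξ
  rw [hξ]

theorem fourierLaplace_complexPoint (h : ℝ^n → ℂ) (x y : ℝ^n) :
    fourierLaplace h (complexPoint x y) =
      𝓕⁻ (fun ξ => h ξ * planeWave ξ (complexPoint 0 y)) x := by
  rw [fourierLaplace, Real.fourierInv_eq']
  refine integral_congr_ae (.of_forall fun ξ => ?_)
  simp only [complexPoint_eq_add x y, planeWave_add, planeWave_complexPoint_zero_right,
    smul_eq_mul]
  ring

theorem fourierLaplace_complexPoint_zero_right (h : ℝ^n → ℂ) (x : ℝ^n) :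
    fourierLaplace h (complexPoint x 0) = 𝓕⁻ h x := by
  simp [fourierLaplace_complexPoint, planeWave]

theorem norm_mul_planeWave_le (h : ℝ^n → ℂ) (ξ : ℝ^n) {z : ℂ^n} {r : ℝ} (hz : ‖z‖ ≤ r) :
    ‖h ξ * planeWave ξ z‖ ≤ ‖Real.exp (2 * Real.pi * r * ‖ξ‖) • h ξ‖ := by
  rw [norm_mul, norm_smul, Real.norm_of_nonneg (Real.exp_nonneg _), mul_comm]
  gcongr
  refine (norm_planeWave_le ξ z).trans (Real.exp_le_exp.2 ?_)
  gcongr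

theorem norm_mul_planeWave_smul_complexDot_le (h : ℝ^n → ℂ) (ξ : ℝ^n) {z : ℂ^n} {r : ℝ}
    (hz : ‖z‖ ≤ r) :
    ‖(h ξ * planeWave ξ z) • (2 * Real.pi * I : ℂ) • complexDot ξ‖ ≤
      ‖Real.exp ((2 * Real.pi * r + 1) * ‖ξ‖) • h ξ‖ * (2 * Real.pi) := by
  have hexp : ‖ξ‖ ≤ Real.exp ‖ξ‖ := by linarith [Real.add_one_le_exp ‖ξ‖]
  calc ‖(h ξ * planeWave ξ z) • (2 * Real.pi * I : ℂ) • complexDot ξ‖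
      = ‖h ξ * planeWave ξ z‖ * (2 * Real.pi * ‖ξ‖) := by
        rw [norm_smul, norm_smul, norm_complexDot, norm_two_pi_I]
    _ ≤ ‖Real.exp (2 * Real.pi * r * ‖ξ‖) • h ξ‖ * (2 * Real.pi * Real.exp ‖ξ‖) := by
        gcongr
        exact norm_mul_planeWave_le h ξ hz
    _ = ‖Real.exp ((2 * Real.pi * r + 1) * ‖ξ‖) • h ξ‖ * (2 * Real.pi) := by
        rw [norm_smul, norm_smul, add_mul, one_mul, Real.exp_add, norm_mul,
          Real.norm_of_nonneg (Real.exp_nonneg ‖ξ‖)]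
        ring

theorem differentiable_fourierLaplace {h : ℝ^n → ℂ}
    (hh : ∀ c : ℝ, Integrable (fun ξ => Real.exp (c * ‖ξ‖) • h ξ) volume) :
    Differentiable ℂ (fourierLaplace h) := by
  intro z₀
  have hmeas (z : ℂ^n) : AEStronglyMeasurable (fun ξ => h ξ * planeWave ξ z) volume := by
    have hm : AEStronglyMeasurable h volume := by simpa using (hh 0).aestronglyMeasurable
    exact hm.mul (continuous_planeWave_left z).aestronglyMeasurable
  have hball {z : ℂ^n} (hz : z ∈ Metric.ball z₀ 1) : ‖z‖ ≤ ‖z₀‖ + 1 := by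
    linarith [norm_sub_norm_le z z₀, mem_ball_iff_norm.1 hz]
  have hderiv (ξ : ℝ^n) (z : ℂ^n) : HasFDerivAt (fun z => h ξ * planeWave ξ z)
      ((h ξ * planeWave ξ z) • (2 * Real.pi * I : ℂ) • complexDot ξ) z := by
    rw [mul_smul]
    exact (hasFDerivAt_planeWave ξ z).const_mul (h ξ)
  have hint : Integrable (fun ξ => h ξ * planeWave ξ z₀) volume :=
    (hh _).norm.mono' (hmeas z₀) (.of_forall fun ξ => norm_mul_planeWave_le h ξ le_rfl)
  have hdot : Continuous fun ξ : ℝ^n => (2 * Real.pi * I : ℂ) • complexDot ξ :=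
    continuous_complexDot.fun_const_smul _
  exact (hasFDerivAt_integral_of_dominated_of_fderiv_le (𝕜 := ℂ)
    (F := fun z ξ => h ξ * planeWave ξ z)
    (F' := fun z ξ => (h ξ * planeWave ξ z) • (2 * Real.pi * I : ℂ) • complexDot ξ)
    (Metric.ball_mem_nhds z₀ one_pos) (.of_forall hmeas) hint
    ((hmeas z₀).smul hdot.aestronglyMeasurable)
    (.of_forall fun ξ z hz => norm_mul_planeWave_smul_complexDot_le h ξ (hball hz))
    ((hh _).norm.mul_const _) (.of_forall fun ξ z _ => hderiv ξ z)).differentiableAt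

theorem isEntireExtension_fourierLaplace {h : ℝ^n → ℂ}
    (hh : ∀ c : ℝ, Integrable (fun ξ => Real.exp (c * ‖ξ‖) • h ξ) volume) :
    IsEntireExtension (𝓕⁻ h) (fourierLaplace h) :=
  ⟨differentiable_fourierLaplace hh, .of_forall (fourierLaplace_complexPoint_zero_right h)⟩

theorem integrable_exp_smul_of_hasCompactSupport {h : ℝ^n → ℂ} (hh : LocallyIntegrable h volume)
    (hh' : HasCompactSupport h) (c : ℝ) :
    Integrable (fun ξ => Real.exp (c * ‖ξ‖) • h ξ) volume :=
  integrable_continuous_smul_of_hasCompactSupport (by fun_prop) hh hh'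

theorem fconv_fourierInv {φ q : ℝ^n → ℂ} (hφ : Integrable φ volume) (hq : Integrable q volume) :
    fconv (𝓕⁻ φ) q = 𝓕⁻ (fun ξ => φ ξ * 𝓕 q ξ) := by
  funext x
  have hflip : fconv (𝓕⁻ φ) q x = ∫ ξ, φ ξ * 𝓕⁻ (fun t => q (x - t)) ξ := by
    rw [← integral_fourierInv_mul_eq_flip hφ (hq.comp_sub_left x)]
    simp [fconv, convolution_def]
  rw [hflip, Real.fourierInv_eq']
  refine integral_congr_ae (.of_forall fun ξ => ?_)
  simp only [smul_eq_mul]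
  rw [mul_left_comm]
  congr 1
  rw [Real.fourierInv_eq', Real.fourier_eq', ← integral_const_mul,
    ← integral_sub_left_eq_self _ volume x]
  refine integral_congr_ae (.of_forall fun t => ?_)
  simp only [smul_eq_mul, sub_sub_cancel]
  rw [← mul_assoc, ← Complex.exp_add, inner_sub_left, real_inner_comm x ξ]
  congr 2
  push_cast
  ring

end FourierLaplace

section LocalConvolution

variable {n : ℕ}

theorem aestronglyMeasurable_convolution_integrand {f q : ℝ^n → ℂ}
    (hf : AEStronglyMeasurable f volume) (hq : AEStronglyMeasurable q volume) (K : Set (ℝ^n)) :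
    AEStronglyMeasurable (fun p : ℝ^n × ℝ^n => q p.2 * f (p.1 - p.2))
      ((volume.restrict K).prod volume) :=
  (hq.convolution_integrand (ContinuousLinearMap.mul ℂ ℂ) hf).mono_measure
    (Measure.prod_mono Measure.restrict_le_self le_rfl)

theorem setLIntegral_enorm_comp_sub_le {f : ℝ^n → ℂ} (hf : AEStronglyMeasurable f volume)
    (K : Set (ℝ^n)) (t : ℝ^n) :
    ∫⁻ x in K, ‖f (x - t)‖ₑ ≤ eLpNorm f 2 volume * volume K ^ (1 / 2 : ℝ) := by
  have hmp := measurePreserving_sub_right (volume : Measure (ℝ^n)) t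
  have hmeas : AEStronglyMeasurable (fun x => f (x - t)) volume := hf.comp_measurePreserving hmp
  have hexp : 1 / (1 : ℝ≥0∞).toReal - 1 / (2 : ℝ≥0∞).toReal = (1 / 2 : ℝ) := by norm_num
  calc ∫⁻ x in K, ‖f (x - t)‖ₑ
      = eLpNorm (fun x => f (x - t)) 1 (volume.restrict K) := eLpNorm_one_eq_lintegral_enorm.symm
    _ ≤ eLpNorm (fun x => f (x - t)) 2 (volume.restrict K) * volume K ^ (1 / 2 : ℝ) := by
        simpa only [hexp, Measure.restrict_apply_univ] using
          eLpNorm_le_eLpNorm_mul_rpow_measure_univ (p := 1) (q := 2) (by norm_num) hmeas.restrict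
    _ ≤ eLpNorm (fun x => f (x - t)) 2 volume * volume K ^ (1 / 2 : ℝ) := by
        gcongr
        exact Measure.restrict_le_self
    _ = eLpNorm f 2 volume * volume K ^ (1 / 2 : ℝ) := by
        rw [← eLpNorm_comp_measurePreserving hf hmp]
        rfl

theorem lintegral_convolution_integrand_le {f q : ℝ^n → ℂ} (hf : AEStronglyMeasurable f volume)
    (hq : AEStronglyMeasurable q volume) (K : Set (ℝ^n)) :
    ∫⁻ x in K, ∫⁻ t, ‖q t * f (x - t)‖ₑ ≤
      (∫⁻ t, ‖q t‖ₑ) * (eLpNorm f 2 volume * volume K ^ (1 / 2 : ℝ)) := by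
  rw [lintegral_lintegral_swap (aestronglyMeasurable_convolution_integrand hf hq K).enorm,
    ← lintegral_mul_const'' _ hq.enorm]
  refine lintegral_mono fun t => ?_
  simp only [enorm_mul]
  rw [lintegral_const_mul' _ _ enorm_ne_top]
  gcongr
  exact setLIntegral_enorm_comp_sub_le hf K t

theorem fconv_eq_integral_swap (f q : ℝ^n → ℂ) (x : ℝ^n) :
    fconv f q x = ∫ t, q t * f (x - t) := by
  simp [fconv, convolution_eq_swap, mul_comm]

theorem lintegral_fconv_le {f q : ℝ^n → ℂ} (hf : AEStronglyMeasurable f volume)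
    (hq : AEStronglyMeasurable q volume) (K : Set (ℝ^n)) :
    ∫⁻ x in K, ‖fconv f q x‖ₑ ≤
      (∫⁻ t, ‖q t‖ₑ) * (eLpNorm f 2 volume * volume K ^ (1 / 2 : ℝ)) := by
  refine (lintegral_mono fun x => ?_).trans (lintegral_convolution_integrand_le hf hq K)
  rw [fconv_eq_integral_swap]
  exact enorm_integral_le_lintegral_enorm _

theorem ae_integrable_convolution_integrand {f q : ℝ^n → ℂ} (hf : MemLp f 2 volume)
    (hq : Integrable q volume) : ∀ᵐ x, Integrable (fun t => q t * f (x - t)) volume := by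
  refine ae_of_forall_measure_lt_top_ae_restrict _ fun K _ hK => ?_
  have hmeas := aestronglyMeasurable_convolution_integrand hf.1 hq.1 K
  have hfin := (lintegral_convolution_integrand_le hf.1 hq.1 K).trans_lt
    (ENNReal.mul_lt_top hq.2 (ENNReal.mul_lt_top hf.2
      (ENNReal.rpow_lt_top_of_nonneg (by norm_num) hK.ne)))
  filter_upwards [ae_lt_top' hmeas.enorm.lintegral_prod_right' hfin.ne, hmeas.prodMk_left]
    with x hx hx'
  exact ⟨hx', hx⟩

theorem fconv_congr_left {f g : ℝ^n → ℂ} (h : f =ᵐ[volume] g) (q : ℝ^n → ℂ) :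
    fconv f q = fconv g q := by
  funext x
  refine integral_congr_ae ?_
  filter_upwards [h] with t ht
  rw [ht]

theorem fconv_add_left {f g q : ℝ^n → ℂ} (hf : MemLp f 2 volume) (hg : MemLp g 2 volume)
    (hq : Integrable q volume) : fconv (f + g) q =ᵐ[volume] fconv f q + fconv g q := by
  filter_upwards [ae_integrable_convolution_integrand hf hq,
    ae_integrable_convolution_integrand hg hq] with x hx hx'
  simp only [Pi.add_apply, fconv_eq_integral_swap, mul_add]
  exact integral_add hx hx'

theorem fconv_smul_left (c : ℂ) (f q : ℝ^n → ℂ) : fconv (c • f) q = c • fconv f q :=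
  smul_convolution

theorem integrableOn_fconv {f q : ℝ^n → ℂ} (hf : MemLp f 2 volume) (hq : Integrable q volume)
    {K : Set (ℝ^n)} (hK : volume K ≠ ∞) : IntegrableOn (fconv f q) K volume := by
  refine ⟨?_, (lintegral_fconv_le hf.1 hq.1 K).trans_lt (ENNReal.mul_lt_top hq.2
    (ENNReal.mul_lt_top hf.2 (ENNReal.rpow_lt_top_of_nonneg (by norm_num) hK)))⟩
  rw [funext (fconv_eq_integral_swap f q)]
  exact (aestronglyMeasurable_convolution_integrand hf.1 hq.1 K).integral_prod_right'

theorem norm_setIntegral_fconv_le {f q : ℝ^n → ℂ} (hf : MemLp f 2 volume)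
    (hq : Integrable q volume) {K : Set (ℝ^n)} (hK : volume K ≠ ∞) :
    ‖∫ x in K, fconv f q x‖ ≤
      (∫⁻ t, ‖q t‖ₑ).toReal * (volume K ^ (1 / 2 : ℝ)).toReal * (eLpNorm f 2 volume).toReal := by
  rw [← ENNReal.toReal_mul, ← ENNReal.toReal_mul, ← toReal_enorm, mul_assoc,
    mul_comm (volume K ^ (1 / 2 : ℝ))]
  refine ENNReal.toReal_mono (ENNReal.mul_ne_top hq.2.ne (ENNReal.mul_ne_top hf.2.ne
    (ENNReal.rpow_ne_top_of_nonneg (by norm_num) hK))) ?_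
  exact (enorm_integral_le_lintegral_enorm _).trans (lintegral_fconv_le hf.1 hq.1 K)

theorem exists_continuousLinearMap_eq_setIntegral_fconv {q : ℝ^n → ℂ} (hq : Integrable q volume)
    {K : Set (ℝ^n)} (hK : volume K ≠ ∞) :
    ∃ L : Lp ℂ 2 (volume : Measure (ℝ^n)) →L[ℂ] ℂ, ∀ φ, L φ = ∫ x in K, fconv φ q x := by
  refine ⟨LinearMap.mkContinuous
    { toFun := fun φ => ∫ x in K, fconv φ q x
      map_add' := fun φ ψ => ?_
      map_smul' := fun c φ => ?_ }
    ((∫⁻ t, ‖q t‖ₑ).toReal * (volume K ^ (1 / 2 : ℝ)).toReal)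
    fun φ => norm_setIntegral_fconv_le (Lp.memLp φ) hq hK, fun φ => rfl⟩
  · rw [← integral_add (integrableOn_fconv (Lp.memLp φ) hq hK)
      (integrableOn_fconv (Lp.memLp ψ) hq hK), fconv_congr_left (Lp.coeFn_add φ ψ)]
    exact integral_congr_ae (ae_restrict_of_ae (fconv_add_left (Lp.memLp φ) (Lp.memLp ψ) hq))
  · rw [fconv_congr_left (Lp.coeFn_smul c φ), fconv_smul_left]
    exact integral_const_mul c _

end LocalConvolution

section BanachSteinhaus

open Filter Topology

variable {E : Type*} [NormedAddCommGroup E] [NormedSpace ℂ E]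

/-- A function `E → ℂ` is a continuous functional if it underlies a continuous linear map. Being
stated for plain functions, the notion can be tested on pointwise limits. -/
def IsContinuousFunctional (e : E → ℂ) : Prop := ∃ L : E →L[ℂ] ℂ, ⇑L = e

namespace IsContinuousFunctional

theorem sub {e e' : E → ℂ} (he : IsContinuousFunctional e) (he' : IsContinuousFunctional e') :
    IsContinuousFunctional fun φ => e φ - e' φ := by
  obtain ⟨L, rfl⟩ := he
  obtain ⟨L', rfl⟩ := he'
  exact ⟨L - L', rfl⟩

theorem const_smul {𝕜 : Type*} [NormedField 𝕜] [NormedSpace 𝕜 ℂ] [SMulCommClass ℂ 𝕜 ℂ]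
    {e : E → ℂ} (he : IsContinuousFunctional e) (c : 𝕜) :
    IsContinuousFunctional fun φ => c • e φ := by
  obtain ⟨L, rfl⟩ := he
  exact ⟨c • L, rfl⟩

theorem sum {ι : Type*} {e : ι → E → ℂ} (he : ∀ i, IsContinuousFunctional (e i)) (s : Finset ι) :
    IsContinuousFunctional fun φ => ∑ i ∈ s, e i φ := by
  choose L hL using he
  exact ⟨∑ i ∈ s, L i, by ext φ; simp [← hL]⟩

variable [CompleteSpace E]

theorem of_tendsto {ι : Type*} {l : Filter ι} [l.IsCountablyGenerated] [l.NeBot]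
    {e : ι → E → ℂ} {e' : E → ℂ} (he : ∀ i, IsContinuousFunctional (e i))
    (h : ∀ φ, Tendsto (fun i => e i φ) l (𝓝 (e' φ))) : IsContinuousFunctional e' := by
  choose L hL using he
  simp only [← hL] at h
  exact ⟨continuousLinearMapOfTendsto L (tendsto_pi_nhds.2 h), rfl⟩

theorem deriv_ofReal {g : E → ℂ → ℂ} (hg : ∀ φ, Differentiable ℂ (g φ))
    (hreal : ∀ t : ℝ, IsContinuousFunctional fun φ => g φ t) (t : ℝ) :
    IsContinuousFunctional fun φ => deriv (g φ) t := by
  refine of_tendsto (l := 𝓝[>] (0 : ℝ))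
    (fun s : ℝ => ((hreal (t + s)).sub (hreal t)).const_smul s⁻¹) fun φ => ?_
  exact ((hg φ).differentiableAt.hasDerivAt.comp_ofReal).tendsto_slope_zero_right

theorem iteratedDeriv_ofReal {g : E → ℂ → ℂ} (hg : ∀ φ, Differentiable ℂ (g φ))
    (hreal : ∀ t : ℝ, IsContinuousFunctional fun φ => g φ t) (k : ℕ) (t : ℝ) :
    IsContinuousFunctional fun φ => iteratedDeriv k (g φ) t := by
  induction k generalizing t with
  | zero => simpa only [iteratedDeriv_zero] using hreal t
  | succ k ih =>
    simp only [iteratedDeriv_succ]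
    exact deriv_ofReal
      (fun φ => (hg φ).contDiff.differentiable_iteratedDeriv (n := ⊤) k (by simp)) ih t

/-- The Taylor coefficients at `0` of an entire function are limits of combinations of its values
on the real axis, so continuity in the parameter propagates from the real axis to the plane. -/
theorem of_forall_ofReal {g : E → ℂ → ℂ} (hg : ∀ φ, Differentiable ℂ (g φ))
    (hreal : ∀ t : ℝ, IsContinuousFunctional fun φ => g φ t) (ζ : ℂ) :
    IsContinuousFunctional fun φ => g φ ζ := by
  refine of_tendsto (l := atTop) (fun s : Finset ℕ => sum (fun k =>
    ((iteratedDeriv_ofReal hg hreal k 0).const_smul ((ζ - 0) ^ k)).const_smul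
      (k.factorial : ℂ)⁻¹) s) fun φ => ?_
  simpa only [HasSum, SummationFilter.unconditional_filter, Complex.ofReal_zero] using
    Complex.hasSum_taylorSeries_of_entire (hg φ) 0 ζ

end IsContinuousFunctional

end BanachSteinhaus

section PointEvaluation

open Filter Topology FourierTransform

theorem tendsto_setAverage_closedBall {X E : Type*} [PseudoMetricSpace X] [ProperSpace X]
    [MeasurableSpace X] [BorelSpace X] {μ : Measure X} [μ.IsOpenPosMeasure]
    [IsFiniteMeasureOnCompacts μ] [NormedAddCommGroup E] [NormedSpace ℝ E] [CompleteSpace E]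
    {f : X → E} {x : X} (hf : ContinuousAt f x) (hf' : StronglyMeasurableAtFilter f (𝓝 x) μ) :
    Tendsto (fun r => ⨍ y in Metric.closedBall x r, f y ∂μ) (𝓝[>] 0) (𝓝 (f x)) := by
  have hlittle := (hf.integral_sub_linear_isLittleO_ae hf'
    ((tendsto_closedBall_smallSets x).mono_left
      (nhdsWithin_le_nhds (s := Set.Ioi 0)))).tendsto_inv_smul_nhds_zero
  refine (by simpa using hlittle.add_const (f x) : Tendsto _ _ (𝓝 (f x))).congr' ?_
  filter_upwards [self_mem_nhdsWithin] with r hr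
  have hpos : μ.real (Metric.closedBall x r) ≠ 0 := by
    rw [measureReal_ne_zero_iff measure_closedBall_lt_top.ne]
    exact (Metric.measure_closedBall_pos μ x hr).ne'
  rw [setAverage_eq, smul_sub, inv_smul_smul₀ hpos, sub_add_cancel]

variable {n : ℕ} {q : ℝ^n → ℂ}

/-- Convolution with `q` maps `L²` into functions with entire extensions to `ℂⁿ`. -/
def HasEntireExtensions (q : ℝ^n → ℂ) : Prop :=
  ∀ f : ℝ^n → ℂ, MemLp f 2 volume → ∃ F, IsEntireExtension (fconv f q) F

section Family

variable {F : Lp ℂ 2 (volume : Measure (ℝ^n)) → ℂ^n → ℂ}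

theorem isContinuousFunctional_entireExtension_ofReal (hq : Integrable q volume)
    (hF : ∀ φ : Lp ℂ 2 (volume : Measure (ℝ^n)), IsEntireExtension (fconv φ q) (F φ)) (x : ℝ^n) :
    IsContinuousFunctional fun φ => F φ (complexPoint x 0) := by
  have haverage (r : ℝ) : IsContinuousFunctional fun φ =>
      ⨍ y in Metric.closedBall x r, F φ (complexPoint y 0) := by
    obtain ⟨L, hL⟩ := exists_continuousLinearMap_eq_setIntegral_fconv hq
      (measure_closedBall_lt_top (μ := volume) (x := x) (r := r)).ne
    simp only [setAverage_eq]
    refine IsContinuousFunctional.const_smul ⟨L, funext fun φ => ?_⟩ _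
    rw [hL]
    exact (integral_congr_ae (ae_restrict_of_ae (hF φ).2)).symm
  refine IsContinuousFunctional.of_tendsto (l := 𝓝[>] 0) haverage fun φ => ?_
  have hcont : Continuous fun y => F φ (complexPoint y 0) :=
    (hF φ).1.continuous.comp continuous_complexPoint_zero_right
  exact tendsto_setAverage_closedBall (f := fun y => F φ (complexPoint y 0)) hcont.continuousAt
    hcont.stronglyMeasurable.stronglyMeasurableAtFilter

theorem isContinuousFunctional_entireExtension (hq : Integrable q volume)
    (hF : ∀ φ : Lp ℂ 2 (volume : Measure (ℝ^n)), IsEntireExtension (fconv φ q) (F φ)) (z : ℂ^n) :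
    IsContinuousFunctional fun φ => F φ z := by
  obtain ⟨x, y, rfl⟩ := exists_complexPoint_eq z
  have hline := IsContinuousFunctional.of_forall_ofReal
    (g := fun φ ζ => F φ (complexLine x y ζ))
    (fun φ => (hF φ).1.comp (differentiable_complexLine x y))
    (fun t => by
      simp only [complexLine_ofReal]
      exact isContinuousFunctional_entireExtension_ofReal hq hF _)
    Complex.I
  simpa only [complexLine_I] using hline

end Family

theorem HasEntireExtensions.exists_inner_eq (hT : HasEntireExtensions q)
    (hq : Integrable q volume) (z : ℂ^n) :
    ∃ k : Lp ℂ 2 (volume : Measure (ℝ^n)), ∀ φ : Lp ℂ 2 (volume : Measure (ℝ^n)), ∀ F,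
      IsEntireExtension (fconv (𝓕⁻ φ : Lp ℂ 2 (volume : Measure (ℝ^n))) q) F →
        F z = inner ℂ k φ := by
  choose F hF using fun φ : Lp ℂ 2 (volume : Measure (ℝ^n)) => hT φ (Lp.memLp φ)
  obtain ⟨L, hL⟩ := isContinuousFunctional_entireExtension hq hF z
  let U := (Lp.fourierTransformₗᵢ (ℝ^n) ℂ).symm
  refine ⟨(InnerProductSpace.toDual ℂ _).symm
    (L ∘L U.toContinuousLinearEquiv.toContinuousLinearMap), fun φ G hG => ?_⟩
  rw [InnerProductSpace.toDual_symm_apply, hG.unique (hF _)]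
  exact (congrFun hL (U φ)).symm

theorem isEntireExtension_fconv_fourierInv_toLp (hq : Integrable q volume) {φ : ℝ^n → ℂ}
    (hφ : Continuous φ) (hφ' : HasCompactSupport φ) (hφL : MemLp φ 2 volume) :
    IsEntireExtension (fconv (𝓕⁻ (hφL.toLp φ) : Lp ℂ 2 (volume : Measure (ℝ^n))) q)
      (fourierLaplace fun ξ => φ ξ * 𝓕 q ξ) := by
  have hint : Integrable φ volume := hφ.integrable_of_hasCompactSupport hφ'
  rw [fconv_congr_left (fourierInv_toLp_ae_eq hint hφL), fconv_fourierInv hint hq]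
  exact isEntireExtension_fourierLaplace (integrable_exp_smul_of_hasCompactSupport
    (hφ.mul (continuous_fourier_of_integrable hq)).locallyIntegrable hφ'.mul_right)

theorem inner_eq_integral_mul_conj (k φ : Lp ℂ 2 (volume : Measure (ℝ^n))) :
    inner ℂ k φ = ∫ ξ, φ ξ * starRingEnd ℂ (k ξ) := by
  simp only [L2.inner_def, RCLike.inner_apply]

theorem conj_ae_eq_fourier_mul_planeWave (hq : Integrable q volume) {z : ℂ^n}
    {k : Lp ℂ 2 (volume : Measure (ℝ^n))}
    (hk : ∀ φ : Lp ℂ 2 (volume : Measure (ℝ^n)), ∀ F,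
      IsEntireExtension (fconv (𝓕⁻ φ : Lp ℂ 2 (volume : Measure (ℝ^n))) q) F →
        F z = inner ℂ k φ) :
    (fun ξ => starRingEnd ℂ (k ξ)) =ᵐ[volume] fun ξ => 𝓕 q ξ * planeWave ξ z := by
  refine ae_eq_of_integral_contDiff_smul_eq
    ((Lp.memLp k).star.locallyIntegrable (by norm_num))
    ((continuous_fourier_of_integrable hq).mul (continuous_planeWave_left z)).locallyIntegrable
    fun g hg hg' => ?_
  let φ : ℝ^n → ℂ := fun ξ => g ξ
  have hφ : Continuous φ := Complex.continuous_ofReal.comp hg.continuous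
  have hφ' : HasCompactSupport φ := hg'.comp_left Complex.ofReal_zero
  have hφL : MemLp φ 2 volume := hφ.memLp_of_hasCompactSupport hφ'
  have heq := hk _ _ (isEntireExtension_fconv_fourierInv_toLp hq hφ hφ' hφL)
  rw [inner_eq_integral_mul_conj, fourierLaplace] at heq
  simp only [Complex.real_smul]
  calc ∫ ξ, φ ξ * starRingEnd ℂ (k ξ)
      = ∫ ξ, hφL.toLp φ ξ * starRingEnd ℂ (k ξ) := by
        refine integral_congr_ae ?_
        filter_upwards [hφL.coeFn_toLp] with ξ hξ
        rw [hξ]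
    _ = ∫ ξ, φ ξ * (𝓕 q ξ * planeWave ξ z) := by simp only [← heq, mul_assoc]

theorem HasEntireExtensions.memLp_fourier_mul_planeWave (hT : HasEntireExtensions q)
    (hq : Integrable q volume) (z : ℂ^n) : MemLp (fun ξ => 𝓕 q ξ * planeWave ξ z) 2 volume := by
  obtain ⟨k, hk⟩ := hT.exists_inner_eq hq z
  exact (memLp_congr_ae (conj_ae_eq_fourier_mul_planeWave hq hk)).1 (Lp.memLp k).star

theorem HasEntireExtensions.entireExtension_eq_fourierLaplace (hT : HasEntireExtensions q)
    (hq : Integrable q volume) {φ : Lp ℂ 2 (volume : Measure (ℝ^n))} {F : ℂ^n → ℂ}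
    (hF : IsEntireExtension (fconv (𝓕⁻ φ : Lp ℂ 2 (volume : Measure (ℝ^n))) q) F) :
    F = fourierLaplace fun ξ => φ ξ * 𝓕 q ξ := by
  funext z
  obtain ⟨k, hk⟩ := hT.exists_inner_eq hq z
  rw [hk φ F hF, inner_eq_integral_mul_conj, fourierLaplace]
  refine integral_congr_ae ?_
  filter_upwards [conj_ae_eq_fourier_mul_planeWave hq hk] with ξ hξ
  rw [hξ, mul_assoc]

end PointEvaluation

section Multiplier

open Filter

variable {α : Type*} [MeasurableSpace α] {μ : Measure α}

theorem eLpNorm_two_sq {E : Type*} [NormedAddCommGroup E] (f : α → E) :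
    eLpNorm f 2 μ ^ 2 = ∫⁻ x, ‖f x‖ₑ ^ 2 ∂μ := by
  simpa using eLpNorm_nnreal_pow_eq_lintegral (μ := μ) (f := f) (p := 2) (by norm_num)

theorem memLp_two_iff_lintegral_lt_top {E : Type*} [NormedAddCommGroup E] {f : α → E}
    (hf : AEStronglyMeasurable f μ) : MemLp f 2 μ ↔ ∫⁻ x, ‖f x‖ₑ ^ 2 ∂μ < ∞ := by
  simp [MemLp, hf, ← eLpNorm_two_sq]

/-- The bumps `1_{A j} / μ (A j)` with `u ≥ 4 ^ j` on `A j`, weighted by `2 ^ (-j)`, add up to such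
a `g`. -/
theorem exists_lintegral_lt_top_lintegral_mul_eq_top [SigmaFinite μ] {u : α → ℝ≥0∞}
    (hu : Measurable u) (hu' : ∀ C : ℝ≥0, ∃ᵐ x ∂μ, C < u x) :
    ∃ g : α → ℝ≥0∞, Measurable g ∧ ∫⁻ x, g x ∂μ < ∞ ∧ ∫⁻ x, u x * g x ∂μ = ∞ := by
  have hset (j : ℕ) : ∃ t, MeasurableSet t ∧ t ⊆ {x | ((4 ^ j : ℝ≥0) : ℝ≥0∞) < u x} ∧
      0 < μ t ∧ μ t < ∞ :=
    Measure.exists_subset_measure_lt_top (measurableSet_lt measurable_const hu)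
      (pos_iff_ne_zero.2 (frequently_ae_iff.1 (hu' (4 ^ j))))
  choose A hAm hAu hA0 hAtop using hset
  let bump (j : ℕ) : α → ℝ≥0∞ := (A j).indicator fun _ => 2⁻¹ ^ j / μ (A j)
  have hbump (j : ℕ) : Measurable (bump j) := measurable_const.indicator (hAm j)
  have hint (j : ℕ) : ∫⁻ x, bump j x ∂μ = 2⁻¹ ^ j := by
    rw [lintegral_indicator_const (hAm j), ENNReal.div_mul_cancel (hA0 j).ne' (hAtop j).ne]
  refine ⟨fun x => ∑' j, bump j x, Measurable.tsum hbump, ?_, ?_⟩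
  · simp only [lintegral_tsum fun j => (hbump j).aemeasurable, hint]
    simp [ENNReal.tsum_geometric, ENNReal.one_sub_inv_two]
  refine top_unique (le_of_tendsto' (ENNReal.tendsto_pow_atTop_nhds_top_iff.2 ENNReal.one_lt_two)
    fun j => ?_)
  calc (2 : ℝ≥0∞) ^ j = 4 ^ j * 2⁻¹ ^ j := by
        rw [show (4 : ℝ≥0∞) = 2 * 2 by norm_num, ← mul_pow, mul_assoc,
          ENNReal.mul_inv_cancel two_ne_zero ENNReal.ofNat_ne_top, mul_one]
    _ = ∫⁻ x, 4 ^ j * bump j x ∂μ := by rw [lintegral_const_mul _ (hbump j), hint]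
    _ ≤ ∫⁻ x, u x * ∑' i, bump i x ∂μ := lintegral_mono fun x => ?_
  by_cases hx : x ∈ A j
  · gcongr
    · simpa using (hAu j hx).le
    · exact ENNReal.le_tsum j
  · simp [bump, hx]

theorem exists_enorm_rpow_ae_eq {𝕜 : Type*} [RCLike 𝕜] {g : α → ℝ≥0∞} (hg : Measurable g)
    (hg' : ∫⁻ x, g x ∂μ < ∞) {p : ℝ} (hp : 0 < p) :
    ∃ φ : α → 𝕜, Measurable φ ∧ (fun x => ‖φ x‖ₑ ^ p) =ᵐ[μ] g := by
  refine ⟨fun x => ((g x ^ p⁻¹).toReal : 𝕜), by fun_prop, ?_⟩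
  filter_upwards [ae_lt_top hg hg'.ne] with x hx
  rw [← ofReal_norm, RCLike.norm_ofReal, abs_of_nonneg ENNReal.toReal_nonneg,
    ENNReal.ofReal_toReal (ENNReal.rpow_ne_top_of_nonneg (by positivity) hx.ne),
    ENNReal.rpow_inv_rpow hp.ne']

variable {𝕜 : Type*} [RCLike 𝕜] {p : ℝ≥0∞}

theorem memLp_top_of_forall_memLp_mul [SigmaFinite μ] {k : α → 𝕜} (hk : Measurable k)
    (hp : p ≠ 0) (hp' : p ≠ ∞)
    (h : ∀ φ : α → 𝕜, MemLp φ p μ → MemLp (fun x => k x * φ x) p μ) : MemLp k ∞ μ := by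
  refine ⟨hk.aestronglyMeasurable, ?_⟩
  by_contra htop
  have hp0 : 0 < p.toReal := ENNReal.toReal_pos hp hp'
  have hfreq (C : ℝ≥0) : ∃ᵐ x ∂μ, C < ‖k x‖ₑ ^ p.toReal := by
    intro hC
    simp only [not_lt, ← ENNReal.le_rpow_inv_iff hp0] at hC
    refine htop ((essSup_le_of_ae_le _ hC).trans_lt ?_)
    exact ENNReal.rpow_lt_top_of_nonneg (by positivity) ENNReal.coe_ne_top
  obtain ⟨g, hg, hgfin, hgtop⟩ :=
    exists_lintegral_lt_top_lintegral_mul_eq_top (hk.enorm.pow_const p.toReal) hfreq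
  obtain ⟨φ, hφ, hφg⟩ := exists_enorm_rpow_ae_eq (𝕜 := 𝕜) hg hgfin hp0
  have hφp : MemLp φ p μ := by
    refine ⟨hφ.aestronglyMeasurable, ?_⟩
    rwa [eLpNorm_lt_top_iff_lintegral_rpow_enorm_lt_top hp hp', lintegral_congr_ae hφg]
  have hkφ := (eLpNorm_lt_top_iff_lintegral_rpow_enorm_lt_top hp hp').1 (h φ hφp).2
  refine hkφ.ne (Eq.trans (lintegral_congr_ae ?_) hgtop)
  filter_upwards [hφg] with x hx
  rw [enorm_mul, ENNReal.mul_rpow_of_nonneg _ _ hp0.le, hx]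

theorem ae_eq_zero_of_forall_exists_mul_ae_eq [SigmaFinite μ] {u v : α → 𝕜}
    (h : ∀ φ : α → 𝕜, MemLp φ p μ → ∃ ψ : α → 𝕜, (fun x => u x * φ x) =ᵐ[μ] fun x => ψ x * v x) :
    ∀ᵐ x ∂μ, v x = 0 → u x = 0 := by
  have hspan (N : ℕ) : ∀ᵐ x ∂μ, x ∈ spanningSets μ N → v x = 0 → u x = 0 := by
    obtain ⟨ψ, hψ⟩ := h ((spanningSets μ N).indicator fun _ => 1)
      (memLp_indicator_const p (measurableSet_spanningSets μ N) 1
        (Or.inr (measure_spanningSets_lt_top μ N).ne))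
    filter_upwards [hψ] with x hx hxN hv
    simpa [hv, hxN] using hx
  filter_upwards [ae_all_iff.2 hspan] with x hx
  exact hx (spanningSetsIndex μ x) (mem_spanningSetsIndex μ x)

theorem exists_ae_norm_le_mul_norm [SigmaFinite μ] {u v : α → 𝕜} (hu : Measurable u)
    (hv : Measurable v) (hp : p ≠ 0) (hp' : p ≠ ∞)
    (h : ∀ φ : α → 𝕜, MemLp φ p μ → ∃ ψ : α → 𝕜, MemLp ψ p μ ∧
      (fun x => u x * φ x) =ᵐ[μ] fun x => ψ x * v x) :
    ∃ C : ℝ, ∀ᵐ x ∂μ, ‖u x‖ ≤ C * ‖v x‖ := by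
  have hdiv : MemLp (u / v) ∞ μ := by
    refine memLp_top_of_forall_memLp_mul (hu.div hv) hp hp' fun φ hφ => ?_
    obtain ⟨ψ, hψ, heq⟩ := h φ hφ
    refine hψ.of_le ((hu.div hv).aestronglyMeasurable.mul hφ.aestronglyMeasurable) ?_
    filter_upwards [heq] with x hx
    simp only [Pi.div_apply]
    by_cases hvx : v x = 0
    · simp [hvx]
    · rw [div_mul_eq_mul_div, hx, mul_div_cancel_right₀ _ hvx]
  obtain ⟨C, hC⟩ := eLpNormEssSup_lt_top_iff_isBoundedUnder.1 hdiv.2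
  refine ⟨C, ?_⟩
  filter_upwards [eventually_map.1 hC, ae_eq_zero_of_forall_exists_mul_ae_eq fun φ hφ =>
    (h φ hφ).imp fun ψ hψ => hψ.2] with x hx hx0
  by_cases hvx : v x = 0
  · simp [hvx, hx0 hvx]
  · have hle : ‖u x / v x‖ ≤ C := hx
    rwa [norm_div, div_le_iff₀ (norm_pos_iff.2 hvx)] at hle

end Multiplier

section BergmanNorm

open FourierTransform RealInnerProductSpace

theorem memLp_mul_continuous_of_hasCompactSupport {X : Type*} [TopologicalSpace X]
    [MeasurableSpace X] [OpensMeasurableSpace X] {μ : Measure X} {p : ℝ≥0∞} {h g : X → ℂ}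
    (hh : MemLp h p μ) (hh' : HasCompactSupport h) (hg : Continuous g) :
    MemLp (fun x => h x * g x) p μ := by
  obtain ⟨C, hC⟩ := hh'.isCompact.exists_bound_of_continuousOn hg.continuousOn
  refine hh.of_le_mul (c := C) (hh.aestronglyMeasurable.mul hg.aestronglyMeasurable)
    (.of_forall fun x => ?_)
  rw [norm_mul, mul_comm]
  by_cases hx : x ∈ tsupport h
  · gcongr
    exact hC x hx
  · simp [image_eq_zero_of_notMem_tsupport hx]

variable {n : ℕ}

theorem lintegral_enorm_fourierInv_sq {φ : ℝ^n → ℂ} (hφ : Integrable φ volume)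
    (hφ' : MemLp φ 2 volume) : ∫⁻ x, ‖𝓕⁻ φ x‖ₑ ^ 2 = ∫⁻ ξ, ‖φ ξ‖ₑ ^ 2 := by
  have hnorm : ‖(𝓕⁻ (hφ'.toLp φ) : Lp ℂ 2 (volume : Measure (ℝ^n)))‖ = ‖hφ'.toLp φ‖ :=
    (Lp.fourierTransformₗᵢ (ℝ^n) ℂ).symm.norm_map _
  have henorm := congrArg ENNReal.ofReal hnorm
  rw [ofReal_norm, ofReal_norm, Lp.enorm_def, Lp.enorm_def,
    eLpNorm_congr_ae (fourierInv_toLp_ae_eq hφ hφ'), eLpNorm_congr_ae hφ'.coeFn_toLp] at henorm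
  rw [← eLpNorm_two_sq, ← eLpNorm_two_sq, henorm]

/-- The Laplace transform `ξ ↦ ∫ w(y) exp (-4π ξ·y) dy` of the weight `w`: the weight on the Fourier
side for which `F = fourierLaplace h` has squared Bergman norm `∫ |h|² laplaceWeight w`. -/
noncomputable def laplaceWeight (w : ℝ^n → ℝ≥0) (ξ : ℝ^n) : ℝ≥0∞ :=
  ∫⁻ y, ENNReal.ofReal (Real.exp (-(4 * Real.pi * ⟪ξ, y⟫))) * w y

theorem enorm_planeWave_sq (ξ x y : ℝ^n) : ‖planeWave ξ (complexPoint x y)‖ₑ ^ 2 =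
    ENNReal.ofReal (Real.exp (-(4 * Real.pi * ⟪ξ, y⟫))) := by
  rw [← ofReal_norm, norm_planeWave, ← ENNReal.ofReal_pow (Real.exp_nonneg _), ← Real.exp_nat_mul]
  congr 2
  push_cast
  ring

variable {w : ℝ^n → ℝ≥0}

theorem measurable_laplaceWeight (hw : Measurable w) : Measurable (laplaceWeight w) := by
  have hm : Measurable fun p : ℝ^n × ℝ^n =>
      ENNReal.ofReal (Real.exp (-(4 * Real.pi * ⟪p.1, p.2⟫))) * (w p.2 : ℝ≥0∞) := by fun_prop
  exact hm.lintegral_prod_right'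

theorem lintegral_enorm_fourierLaplace_sq_mul (hw : Measurable w) {h : ℝ^n → ℂ}
    (hh : MemLp h 2 volume) (hh' : HasCompactSupport h) :
    ∫⁻ p : ℝ^n × ℝ^n, ‖fourierLaplace h (complexPoint p.1 p.2)‖ₑ ^ 2 * (w p.2 : ℝ≥0∞) =
      ∫⁻ ξ, ‖h ξ‖ₑ ^ 2 * laplaceWeight w ξ := by
  have hcont : Continuous (fourierLaplace h) := (differentiable_fourierLaplace
    (integrable_exp_smul_of_hasCompactSupport (hh.locallyIntegrable one_le_two) hh')).continuous
  have hplancherel (y : ℝ^n) :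
      ∫⁻ x, ‖fourierLaplace h (complexPoint x y)‖ₑ ^ 2 * (w y : ℝ≥0∞) =
        ∫⁻ ξ, ‖h ξ‖ₑ ^ 2 * (ENNReal.ofReal (Real.exp (-(4 * Real.pi * ⟪ξ, y⟫))) * w y) := by
    have hL := memLp_mul_continuous_of_hasCompactSupport hh hh'
      (continuous_planeWave_left (complexPoint 0 y))
    have hint := integrable_of_locallyIntegrable_of_hasCompactSupport
      (hL.locallyIntegrable one_le_two) hh'.mul_right
    rw [lintegral_mul_const' _ _ ENNReal.coe_ne_top]
    simp only [fourierLaplace_complexPoint]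
    rw [lintegral_enorm_fourierInv_sq hint hL, ← lintegral_mul_const' _ _ ENNReal.coe_ne_top]
    simp only [enorm_mul, mul_pow, mul_assoc, enorm_planeWave_sq]
  rw [Measure.volume_eq_prod, lintegral_prod_symm' _ (by
    have := (hcont.comp continuous_complexPoint).measurable
    exact (this.enorm.pow_const 2).mul (hw.comp measurable_snd).coe_nnreal_ennreal)]
  simp only [hplancherel]
  rw [lintegral_lintegral_swap]
  · refine lintegral_congr fun ξ => ?_
    rw [laplaceWeight, lintegral_const_mul' _ _ (by finiteness)]
  · have hm : AEMeasurable (fun p : ℝ^n × ℝ^n => ‖h p.2‖ₑ ^ 2) (volume.prod volume) :=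
      hh.aestronglyMeasurable.comp_snd.enorm.pow_const 2
    exact hm.mul (by fun_prop)

theorem laplaceWeight_add_le (hw : Measurable w) (ξ η : ℝ^n) {a b : ℝ} (ha : 0 ≤ a) (hb : 0 ≤ b)
    (hab : a + b = 1) : laplaceWeight w (a • ξ + b • η) ≤
      ENNReal.ofReal a * laplaceWeight w ξ + ENNReal.ofReal b * laplaceWeight w η := by
  simp only [laplaceWeight]
  rw [← lintegral_const_mul _ (by fun_prop), ← lintegral_const_mul _ (by fun_prop),
    ← lintegral_add_left (by fun_prop)]
  refine lintegral_mono fun y => ?_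
  rw [← mul_assoc, ← mul_assoc, ← add_mul, ← ENNReal.ofReal_mul ha, ← ENNReal.ofReal_mul hb,
    ← ENNReal.ofReal_add (by positivity) (by positivity)]
  gcongr
  have hexp := convexOn_exp.2 (Set.mem_univ (-(4 * Real.pi * ⟪ξ, y⟫)))
    (Set.mem_univ (-(4 * Real.pi * ⟪η, y⟫))) ha hb hab
  refine (Real.exp_le_exp.2 (le_of_eq ?_)).trans hexp
  simp only [inner_add_left, real_inner_smul_left, smul_eq_mul]
  ring

theorem convex_laplaceWeight_lt_top (hw : Measurable w) :
    Convex ℝ {ξ | laplaceWeight w ξ < ∞} := fun ξ hξ η hη _ _ ha hb hab =>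
  (laplaceWeight_add_le hw ξ η ha hb hab).trans_lt
    (ENNReal.add_lt_top.2 ⟨ENNReal.mul_lt_top ENNReal.ofReal_lt_top hξ,
      ENNReal.mul_lt_top ENNReal.ofReal_lt_top hη⟩)

theorem convexOn_toReal_laplaceWeight (hw : Measurable w) :
    ConvexOn ℝ {ξ | laplaceWeight w ξ < ∞} fun ξ => (laplaceWeight w ξ).toReal := by
  refine ⟨convex_laplaceWeight_lt_top hw, fun ξ hξ η hη a b ha hb hab => ?_⟩
  have hξ' : ENNReal.ofReal a * laplaceWeight w ξ < ∞ :=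
    ENNReal.mul_lt_top ENNReal.ofReal_lt_top hξ
  have hη' : ENNReal.ofReal b * laplaceWeight w η < ∞ :=
    ENNReal.mul_lt_top ENNReal.ofReal_lt_top hη
  have hle := ENNReal.toReal_mono (ENNReal.add_lt_top.2 ⟨hξ', hη'⟩).ne
    (laplaceWeight_add_le hw ξ η ha hb hab)
  rwa [ENNReal.toReal_add hξ'.ne hη'.ne, ENNReal.toReal_mul, ENNReal.toReal_mul,
    ENNReal.toReal_ofReal ha, ENNReal.toReal_ofReal hb] at hle

theorem exists_laplaceWeight_le_of_mem_interior (hw : Measurable w) {ξ₀ : ℝ^n}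
    (hξ₀ : ξ₀ ∈ interior {ξ | laplaceWeight w ξ < ∞}) :
    ∃ r > 0, ∃ M : ℝ≥0, ∀ ξ ∈ Metric.closedBall ξ₀ r, laplaceWeight w ξ ≤ M := by
  obtain ⟨r, hr, hball⟩ := Metric.nhds_basis_closedBall.mem_iff.1 (isOpen_interior.mem_nhds hξ₀)
  obtain ⟨M, hM⟩ := (isCompact_closedBall ξ₀ r).exists_bound_of_continuousOn
    ((convexOn_toReal_laplaceWeight hw).continuousOn_interior.mono hball)
  refine ⟨r, hr, M.toNNReal, fun ξ hξ => ?_⟩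
  have hfin : ξ ∈ {ξ | laplaceWeight w ξ < ∞} := interior_subset (hball hξ)
  rw [Set.mem_ofPred_eq] at hfin
  rw [← ENNReal.ofReal_toReal hfin.ne]
  exact ENNReal.ofReal_le_ofReal ((le_abs_self _).trans (hM ξ hξ))

end BergmanNorm

section ImageOfTransform

open FourierTransform

theorem subset_of_convex_of_ae_mem {E : Type*} [NormedAddCommGroup E] [NormedSpace ℝ E]
    [MeasurableSpace E] [BorelSpace E] {μ : Measure E} [μ.IsAddLeftInvariant] [μ.IsNegInvariant]
    [μ.IsOpenPosMeasure] {s U : Set E} (hs : Convex ℝ s) (hU : IsOpen U)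
    (h : ∀ᵐ x ∂μ, x ∈ U → x ∈ s) : U ⊆ s := by
  intro a ha
  have hpre := (Measure.measurePreserving_sub_left μ ((2 : ℝ) • a)).quasiMeasurePreserving.ae h
  have hopen : IsOpen (U ∩ (fun x => (2 : ℝ) • a - x) ⁻¹' U) :=
    hU.inter (hU.preimage (by fun_prop))
  obtain ⟨x, ⟨hxU, hxU'⟩, hx, hx'⟩ := (Measure.dense_of_ae (h.and hpre)).inter_open_nonempty _
    hopen ⟨a, ha, by simpa [two_smul] using ha⟩
  have hmid := hs (hx hxU) (hx' hxU') (a := 1 / 2) (b := 1 / 2) (by norm_num) (by norm_num)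
    (by norm_num)
  rwa [← smul_add, add_sub_cancel, smul_smul, one_div_mul_cancel two_ne_zero, one_smul] at hmid

variable {n : ℕ} {q : ℝ^n → ℂ} {w : ℝ^n → ℝ≥0}

theorem HasEntireExtensions.memLp_fourier (hT : HasEntireExtensions q)
    (hq : Integrable q volume) : MemLp (𝓕 q) 2 volume := by
  simpa [planeWave] using hT.memLp_fourier_mul_planeWave hq 0

theorem HasEntireExtensions.isEntireExtension_fourierLaplace (hT : HasEntireExtensions q)
    (hq : Integrable q volume) (φ : Lp ℂ 2 (volume : Measure (ℝ^n))) :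
    IsEntireExtension (fconv (𝓕⁻ φ : Lp ℂ 2 (volume : Measure (ℝ^n))) q)
      (fourierLaplace fun ξ => φ ξ * 𝓕 q ξ) := by
  obtain ⟨F, hF⟩ := hT _ (Lp.memLp (𝓕⁻ φ : Lp ℂ 2 (volume : Measure (ℝ^n))))
  rwa [← hT.entireExtension_eq_fourierLaplace hq hF]

namespace ImageIsBergman

theorem hasEntireExtensions (himage : ImageIsBergman q w) : HasEntireExtensions q := fun f hf =>
  let ⟨F, _, hF⟩ := himage.1 f hf
  ⟨F, hF⟩

theorem integrable_mul_fourier (himage : ImageIsBergman q w) (hq : Integrable q volume)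
    {φ : ℝ^n → ℂ} (hφ : MemLp φ 2 volume) : Integrable (fun ξ => φ ξ * 𝓕 q ξ) volume :=
  hφ.integrable_mul (himage.hasEntireExtensions.memLp_fourier hq)

theorem exists_eq_fourierLaplace (himage : ImageIsBergman q w) (hq : Integrable q volume)
    {F : ℂ^n → ℂ} (hF : F ∈ weightedBergman w) :
    ∃ φ : ℝ^n → ℂ, MemLp φ 2 volume ∧ F = fourierLaplace fun ξ => φ ξ * 𝓕 q ξ := by
  obtain ⟨f, hf, hfF⟩ := himage.2 F hF
  refine ⟨(𝓕 (hf.toLp f) : Lp ℂ 2 (volume : Measure (ℝ^n))), Lp.memLp _,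
    himage.hasEntireExtensions.entireExtension_eq_fourierLaplace hq ?_⟩
  rwa [FourierTransform.fourierInv_fourier_eq, fconv_congr_left hf.coeFn_toLp]

theorem fourierLaplace_mem_weightedBergman (himage : ImageIsBergman q w)
    (hq : Integrable q volume) {φ : ℝ^n → ℂ} (hφ : MemLp φ 2 volume) :
    (fourierLaplace fun ξ => φ ξ * 𝓕 q ξ) ∈ weightedBergman w := by
  obtain ⟨F, hFB, hF⟩ := himage.1 _ (Lp.memLp (𝓕⁻ (hφ.toLp φ) : Lp ℂ 2 (volume : Measure (ℝ^n))))
  rwa [himage.hasEntireExtensions.entireExtension_eq_fourierLaplace hq hF,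
    fourierLaplace_mul_congr_left hφ.coeFn_toLp] at hFB

theorem exists_ae_eq_mul_fourier (himage : ImageIsBergman q w) (hq : Integrable q volume)
    (hw : Measurable w) {h : ℝ^n → ℂ} (hh : MemLp h 2 volume) (hh' : HasCompactSupport h)
    (hfin : ∫⁻ ξ, ‖h ξ‖ₑ ^ 2 * laplaceWeight w ξ < ∞) :
    ∃ φ : ℝ^n → ℂ, MemLp φ 2 volume ∧ h =ᵐ[volume] fun ξ => φ ξ * 𝓕 q ξ := by
  have hloc := hh.locallyIntegrable one_le_two
  have hdiff := differentiable_fourierLaplace (integrable_exp_smul_of_hasCompactSupport hloc hh')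
  obtain ⟨φ, hφ, heq⟩ := himage.exists_eq_fourierLaplace hq (F := fourierLaplace h)
    ⟨hdiff, by rwa [lintegral_enorm_fourierLaplace_sq_mul hw hh hh']⟩
  refine ⟨φ, hφ, ae_eq_of_fourierInv_eq (integrable_of_locallyIntegrable_of_hasCompactSupport
    hloc hh') (himage.integrable_mul_fourier hq hφ) ?_⟩
  funext x
  rw [← fourierLaplace_complexPoint_zero_right, heq, fourierLaplace_complexPoint_zero_right]

theorem exists_ae_one_le_mul_norm_fourier (himage : ImageIsBergman q w) (hq : Integrable q volume)
    (hw : Measurable w) {K : Set (ℝ^n)} (hK : IsCompact K) {M : ℝ≥0}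
    (hM : ∀ ξ ∈ K, laplaceWeight w ξ ≤ M) : ∃ C : ℝ, ∀ᵐ ξ, ξ ∈ K → 1 ≤ C * ‖𝓕 q ξ‖ := by
  obtain ⟨C, hC⟩ := exists_ae_norm_le_mul_norm (μ := volume) (p := 2)
    (u := K.indicator fun _ => (1 : ℂ)) (measurable_const.indicator hK.measurableSet)
    (continuous_fourier_of_integrable hq).measurable two_ne_zero ENNReal.ofNat_ne_top
    fun φ hφ => by
      have hmul : (fun ξ => K.indicator (fun _ => (1 : ℂ)) ξ * φ ξ) = K.indicator φ := by
        simp only [← Set.indicator_mul_left, one_mul]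
      rw [hmul]
      refine himage.exists_ae_eq_mul_fourier hq hw (hφ.indicator hK.measurableSet)
        (.intro hK fun ξ hξ => Set.indicator_of_notMem hξ _) ?_
      calc ∫⁻ ξ, ‖K.indicator φ ξ‖ₑ ^ 2 * laplaceWeight w ξ
          ≤ ∫⁻ ξ, ‖φ ξ‖ₑ ^ 2 * M := by
            refine lintegral_mono fun ξ => ?_
            by_cases hξ : ξ ∈ K
            · simp only [Set.indicator_of_mem hξ]
              gcongr
              exact hM ξ hξ
            · simp [Set.indicator_of_notMem hξ]
        _ = (∫⁻ ξ, ‖φ ξ‖ₑ ^ 2) * M := lintegral_mul_const' _ _ ENNReal.coe_ne_top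
        _ < ∞ := ENNReal.mul_lt_top
            ((memLp_two_iff_lintegral_lt_top hφ.aestronglyMeasurable).1 hφ) ENNReal.coe_lt_top
  refine ⟨C, ?_⟩
  filter_upwards [hC] with ξ hξ hξK
  simpa [hξK] using hξ

theorem fourier_ne_zero_of_mem_interior (himage : ImageIsBergman q w) (hq : Integrable q volume)
    (hw : Measurable w) {ξ₀ : ℝ^n} (hξ₀ : ξ₀ ∈ interior {ξ | laplaceWeight w ξ < ∞}) :
    𝓕 q ξ₀ ≠ 0 := by
  obtain ⟨r, hr, M, hM⟩ := exists_laplaceWeight_le_of_mem_interior hw hξ₀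
  obtain ⟨C, hC⟩ := himage.exists_ae_one_le_mul_norm_fourier hq hw (isCompact_closedBall ξ₀ r) hM
  intro hzero
  have hopen : IsOpen ({ξ | C * ‖𝓕 q ξ‖ < 1} ∩ Metric.ball ξ₀ r) :=
    (isOpen_lt (continuous_const.mul (continuous_fourier_of_integrable hq).norm)
      continuous_const).inter Metric.isOpen_ball
  obtain ⟨ξ, ⟨hlt, hball⟩, hle⟩ := (Measure.dense_of_ae hC).inter_open_nonempty _ hopen
    ⟨ξ₀, by simp [hzero], Metric.mem_ball_self hr⟩
  exact (hle (Metric.ball_subset_closedBall hball)).not_gt hlt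

theorem ae_laplaceWeight_lt_top (himage : ImageIsBergman q w) (hq : Integrable q volume)
    (hw : Measurable w) {K : Set (ℝ^n)} (hK : IsCompact K) (hK' : ∀ ξ ∈ K, 𝓕 q ξ ≠ 0) :
    ∀ᵐ ξ, ξ ∈ K → laplaceWeight w ξ < ∞ := by
  have hcont := continuous_fourier_of_integrable hq
  have hφ : MemLp (K.indicator fun _ => (1 : ℂ)) 2 volume :=
    memLp_indicator_const 2 hK.measurableSet 1 (Or.inr hK.measure_lt_top.ne)
  have hφ' : HasCompactSupport (K.indicator fun _ => (1 : ℂ)) :=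
    .intro hK fun ξ hξ => Set.indicator_of_notMem hξ _
  have hnorm := (himage.fourierLaplace_mem_weightedBergman hq hφ).2
  rw [lintegral_enorm_fourierLaplace_sq_mul hw
    (memLp_mul_continuous_of_hasCompactSupport hφ hφ' hcont) hφ'.mul_right] at hnorm
  filter_upwards [ae_lt_top' (((hφ.aestronglyMeasurable.mul
    hcont.aestronglyMeasurable).enorm.pow_const 2).mul
      (measurable_laplaceWeight hw).aemeasurable) hnorm.ne] with ξ hξ hξK
  refine ENNReal.lt_top_of_mul_ne_top_right hξ.ne ?_
  simpa [hξK] using hK' ξ hξK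

theorem laplaceWeight_lt_top (himage : ImageIsBergman q w) (hq : Integrable q volume)
    (hw : Measurable w) {ξ₀ : ℝ^n} (hξ₀ : 𝓕 q ξ₀ ≠ 0) : laplaceWeight w ξ₀ < ∞ := by
  obtain ⟨r, hr, hball⟩ := Metric.nhds_basis_closedBall.mem_iff.1
    ((isOpen_ne_fun (continuous_fourier_of_integrable hq) continuous_const).mem_nhds hξ₀)
  have hae := himage.ae_laplaceWeight_lt_top hq hw (isCompact_closedBall ξ₀ r) hball
  exact subset_of_convex_of_ae_mem (convex_laplaceWeight_lt_top hw) Metric.isOpen_ball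
    (hae.mono fun ξ hξ hξball => hξ (Metric.ball_subset_closedBall hξball))
    (Metric.mem_ball_self hr)

theorem setOf_fourier_ne_zero_eq_interior (himage : ImageIsBergman q w)
    (hq : Integrable q volume) (hw : Measurable w) :
    {ξ | 𝓕 q ξ ≠ 0} = interior {ξ | laplaceWeight w ξ < ∞} :=
  Set.Subset.antisymm
    (interior_maximal (fun _ => himage.laplaceWeight_lt_top hq hw)
      (isOpen_ne_fun (continuous_fourier_of_integrable hq) continuous_const))
    fun _ => himage.fourier_ne_zero_of_mem_interior hq hw

theorem isPreconnected_fourier_ne_zero (himage : ImageIsBergman q w) (hq : Integrable q volume)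
    (hw : Measurable w) : IsPreconnected {ξ | 𝓕 q ξ ≠ 0} := by
  rw [himage.setOf_fourier_ne_zero_eq_interior hq hw]
  exact (convex_laplaceWeight_lt_top hw).interior.isPreconnected

end ImageIsBergman

theorem comp_neg_mem_weightedBergman (hw : Measurable w) (heven : ∀ y, w (-y) = w y)
    {F : ℂ^n → ℂ} (hF : F ∈ weightedBergman w) : (fun z => F (-z)) ∈ weightedBergman w := by
  refine ⟨hF.1.comp differentiable_id.neg, ?_⟩
  have hm : Measurable fun p : ℝ^n × ℝ^n => ‖F (complexPoint p.1 p.2)‖ₑ ^ 2 * (w p.2 : ℝ≥0∞) :=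
    ((hF.1.continuous.comp continuous_complexPoint).measurable.enorm.pow_const 2).mul
      (hw.comp measurable_snd).coe_nnreal_ennreal
  have hneg := ((Measure.measurePreserving_neg (volume : Measure (ℝ^n))).prod
    (Measure.measurePreserving_neg (volume : Measure (ℝ^n)))).lintegral_comp hm
  refine lt_of_eq_of_lt (lintegral_congr fun p => ?_) (hneg.trans_lt hF.2)
  simp only [neg_complexPoint, Prod.map_fst, Prod.map_snd, heven]

theorem fourierLaplace_neg (h : ℝ^n → ℂ) (z : ℂ^n) :
    fourierLaplace h (-z) = fourierLaplace (fun ξ => h (-ξ)) z := by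
  have hwave (ξ : ℝ^n) : planeWave (-ξ) (-z) = planeWave ξ z := by
    rw [planeWave, planeWave, complexDot, complexDot, ← neg_zero, ← neg_complexPoint]
    simp
  rw [fourierLaplace, fourierLaplace, ← integral_neg_eq_self]
  simp only [hwave]

theorem ImageIsBergman.exists_ae_norm_fourier_neg_le (himage : ImageIsBergman q w)
    (hq : Integrable q volume) (hw : Measurable w) (heven : ∀ y, w (-y) = w y) :
    ∃ C : ℝ, ∀ᵐ ξ, ‖𝓕 q (-ξ)‖ ≤ C * ‖𝓕 q ξ‖ := by
  have hcont := continuous_fourier_of_integrable hq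
  refine exists_ae_norm_le_mul_norm (p := 2) (u := fun ξ => 𝓕 q (-ξ))
    (hcont.comp continuous_neg).measurable hcont.measurable two_ne_zero ENNReal.ofNat_ne_top
    fun φ hφ => ?_
  have hφ' : MemLp (fun ξ => φ (-ξ)) 2 volume :=
    hφ.comp_measurePreserving (Measure.measurePreserving_neg volume)
  obtain ⟨ψ, hψ, heq⟩ := himage.exists_eq_fourierLaplace hq
    (comp_neg_mem_weightedBergman hw heven (himage.fourierLaplace_mem_weightedBergman hq hφ'))
  have hint : Integrable (fun ξ => 𝓕 q (-ξ) * φ ξ) volume := by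
    simpa [mul_comm] using (himage.integrable_mul_fourier hq hφ').comp_neg
  refine ⟨ψ, hψ, ae_eq_of_fourierInv_eq hint (himage.integrable_mul_fourier hq hψ) ?_⟩
  funext x
  rw [← fourierLaplace_complexPoint_zero_right, ← fourierLaplace_complexPoint_zero_right, ← heq]
  simp only [fourierLaplace_neg, neg_neg, mul_comm]

end ImageOfTransform

section HolomorphicParameter

open Filter Topology

theorem aestronglyMeasurable_deriv_of_eventually {α 𝕜 E : Type*} [MeasurableSpace α]
    {μ : Measure α} [NontriviallyNormedField 𝕜] [NormedAddCommGroup E] [NormedSpace 𝕜 E]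
    {f : 𝕜 → α → E} {ζ₀ : 𝕜} (hmeas : ∀ᶠ ζ in 𝓝 ζ₀, AEStronglyMeasurable (f ζ) μ)
    (hdiff : ∀ᵐ x ∂μ, DifferentiableAt 𝕜 (fun ζ => f ζ x) ζ₀) :
    AEStronglyMeasurable (fun x => deriv (fun ζ => f ζ x) ζ₀) μ := by
  obtain ⟨t, ht⟩ := exists_seq_tendsto (𝓝[≠] ζ₀)
  obtain ⟨N, hN⟩ := eventually_atTop.1 (ht.eventually (hmeas.filter_mono nhdsWithin_le_nhds))
  refine aestronglyMeasurable_of_tendsto_ae atTop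
    (f := fun j x => slope (fun ζ => f ζ x) ζ₀ (t (j + N)))
    (fun j => ((hN _ (Nat.le_add_left N j)).sub hmeas.self_of_nhds).const_smul _) ?_
  filter_upwards [hdiff] with x hx
  exact hx.hasDerivAt.tendsto_slope.comp ((tendsto_add_atTop_iff_nat N).2 ht)

theorem differentiableOn_integral_of_dominated {α E : Type*} [MeasurableSpace α] {μ : Measure α}
    [NormedAddCommGroup E] [NormedSpace ℂ E] {U : Set ℂ} (hU : IsOpen U)
    {f : ℂ → α → E} {g : α → ℝ} (hmeas : ∀ ζ ∈ U, AEStronglyMeasurable (f ζ) μ)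
    (hdiff : ∀ x, DifferentiableOn ℂ (fun ζ => f ζ x) U)
    (hbound : ∀ ζ ∈ U, ∀ x, ‖f ζ x‖ ≤ g x) (hg : Integrable g μ) :
    DifferentiableOn ℂ (fun ζ => ∫ x, f ζ x ∂μ) U := by
  intro ζ₀ hζ₀
  obtain ⟨r, hr, hball⟩ := Metric.nhds_basis_closedBall.mem_iff.1 (hU.mem_nhds hζ₀)
  have hsub {ζ : ℂ} (hζ : ζ ∈ Metric.ball ζ₀ (r / 2)) : Metric.closedBall ζ (r / 2) ⊆ U :=
    (Metric.closedBall_subset_closedBall'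
      (by linarith [Metric.mem_ball.1 hζ])).trans hball
  have hderiv {ζ : ℂ} (hζ : ζ ∈ U) (x : α) :
      HasDerivAt (fun ζ => f ζ x) (deriv (fun ζ => f ζ x) ζ) ζ :=
    ((hdiff x).differentiableAt (hU.mem_nhds hζ)).hasDerivAt
  have hcauchy {ζ : ℂ} (hζ : ζ ∈ Metric.ball ζ₀ (r / 2)) (x : α) :
      ‖deriv (fun ζ => f ζ x) ζ‖ ≤ g x / (r / 2) :=
    Complex.norm_deriv_le_of_forall_mem_sphere_norm_le (half_pos hr)
      ((hdiff x).diffContOnCl_ball (hsub hζ))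
      fun η hη => hbound η (hsub hζ (Metric.sphere_subset_closedBall hη)) x
  have hmeas' : ∀ᶠ ζ in 𝓝 ζ₀, AEStronglyMeasurable (f ζ) μ := by
    filter_upwards [hU.mem_nhds hζ₀] with ζ hζ using hmeas ζ hζ
  exact (hasDerivAt_integral_of_dominated_loc_of_deriv_le (𝕜 := ℂ) (F := f)
    (F' := fun ζ x => deriv (fun ζ => f ζ x) ζ) (Metric.ball_mem_nhds ζ₀ (half_pos hr)) hmeas'
    (hg.mono' (hmeas ζ₀ hζ₀) (.of_forall (hbound ζ₀ hζ₀)))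
    (aestronglyMeasurable_deriv_of_eventually hmeas'
      (.of_forall fun x => (hderiv hζ₀ x).differentiableAt))
    (.of_forall fun x ζ hζ => hcauchy hζ x) (hg.div_const _)
    (.of_forall fun x ζ hζ => hderiv (hsub hζ (Metric.mem_closedBall_self (half_pos hr).le)) x)
    ).2.differentiableAt.differentiableWithinAt

theorem exists_forall_notMem_eq_of_norm_le {E : Type*} [NormedAddCommGroup E] [NormedSpace ℂ E]
    [CompleteSpace E] (s : Finset ℂ) {X : ℂ → E} {M : ℝ} (hX : DifferentiableOn ℂ X (↑s)ᶜ)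
    (hM : ∀ ζ ∉ s, ‖X ζ‖ ≤ M) : ∃ c, ∀ ζ ∉ s, X ζ = c := by
  induction s using Finset.induction_on generalizing X M with
  | empty =>
    simp only [Finset.coe_empty, Set.compl_empty, differentiableOn_univ] at hX
    have hbdd : Bornology.IsBounded (Set.range X) := isBounded_iff_forall_norm_le.2
      ⟨M, Set.forall_mem_range.2 fun ζ => hM ζ (Finset.notMem_empty ζ)⟩
    exact ⟨X 0, fun ζ _ => hX.apply_eq_apply_of_bounded hbdd ζ 0⟩
  | insert a s ha ih =>
    have hcompl : (↑(insert a s) : Set ℂ)ᶜ = (↑s)ᶜ \ {a} := by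
      ext ζ
      simp [and_comm]
    rw [hcompl] at hX
    let X' := Function.update X a (limUnder (𝓝[≠] a) X)
    have hX' : DifferentiableOn ℂ X' (↑s)ᶜ := by
      refine Complex.differentiableOn_update_limUnder_of_bddAbove
        (s.finite_toSet.isClosed.isOpen_compl.mem_nhds ha) hX ⟨M, ?_⟩
      rintro _ ⟨ζ, hζ, rfl⟩
      exact hM ζ (Set.ext_iff.1 hcompl ζ |>.2 hζ)
    have hM' : ∀ ζ ∉ s, ‖X' ζ‖ ≤ max M ‖X' a‖ := by
      intro ζ hζ
      by_cases hζa : ζ = a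
      · exact hζa ▸ le_max_right _ _
      · rw [show X' ζ = X ζ from Function.update_of_ne hζa _ _]
        exact (hM ζ (by simp [hζa, hζ])).trans (le_max_left _ _)
    obtain ⟨c, hc⟩ := ih hX' hM'
    refine ⟨c, fun ζ hζ => ?_⟩
    rw [Finset.mem_insert, not_or] at hζ
    exact (Function.update_of_ne hζ.1 _ _).symm.trans (hc ζ hζ.2)

end HolomorphicParameter

section StripReflection

open Complex Filter Topology

/-- The strip `|Im ζ| < 1`, on which the dilation correlation of a function is holomorphic. -/
def horizontalStrip : Set ℂ := {ζ | |ζ.im| < 1}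

/-- The image of the punctured strip `|Im ζ| < 1` under `ζ ↦ ζ⁻¹`, i.e. the complement of the two
closed discs of diameter one which touch the real axis at the origin. -/
def invertedStrip : Set ℂ := {ζ | |ζ.im| < normSq ζ}

theorem isOpen_horizontalStrip : IsOpen horizontalStrip :=
  isOpen_lt (by fun_prop) continuous_const

theorem isOpen_invertedStrip : IsOpen invertedStrip :=
  isOpen_lt (by fun_prop) continuous_normSq

theorem ofReal_mem_horizontalStrip (t : ℝ) : (t : ℂ) ∈ horizontalStrip := by
  simp [horizontalStrip]

theorem ofReal_mem_invertedStrip {t : ℝ} (ht : t ≠ 0) : (t : ℂ) ∈ invertedStrip := by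
  simp [invertedStrip, ht]

theorem ne_zero_of_mem_invertedStrip {ζ : ℂ} (hζ : ζ ∈ invertedStrip) : ζ ≠ 0 := by
  rintro rfl
  simp [invertedStrip] at hζ

theorem conj_inv_mem_horizontalStrip {ζ : ℂ} (hζ : ζ ∈ invertedStrip) :
    starRingEnd ℂ ζ⁻¹ ∈ horizontalStrip := by
  have hpos : 0 < normSq ζ := normSq_pos.2 (ne_zero_of_mem_invertedStrip hζ)
  change |(starRingEnd ℂ ζ⁻¹).im| < 1
  rw [conj_im, inv_im, abs_neg, abs_div, abs_neg, abs_of_pos hpos, div_lt_one hpos]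
  exact hζ

theorem neg_mem_horizontalStrip_inter_invertedStrip {ζ : ℂ}
    (hζ : ζ ∈ horizontalStrip ∩ invertedStrip) : -ζ ∈ horizontalStrip ∩ invertedStrip := by
  simpa [horizontalStrip, invertedStrip] using hζ

theorem re_ne_zero_of_mem_horizontalStrip_inter_invertedStrip {ζ : ℂ}
    (hζ : ζ ∈ horizontalStrip ∩ invertedStrip) : ζ.re ≠ 0 := by
  intro hre
  obtain ⟨hS : |ζ.im| < 1, hV : |ζ.im| < normSq ζ⟩ := hζ
  rw [normSq_apply, hre, ← abs_mul_abs_self ζ.im] at hV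
  nlinarith [abs_nonneg ζ.im]

theorem mem_invertedStrip_of_notMem_horizontalStrip {ζ : ℂ} (hI : ζ ≠ I) (hI' : ζ ≠ -I)
    (hζ : ζ ∉ horizontalStrip) : ζ ∈ invertedStrip := by
  have him : 1 ≤ |ζ.im| := not_lt.1 hζ
  by_contra hV
  have hle : normSq ζ ≤ |ζ.im| := not_lt.1 hV
  rw [normSq_apply, ← abs_mul_abs_self ζ.im] at hle
  have him_eq : |ζ.im| = 1 := by nlinarith [mul_self_nonneg ζ.re]
  have hre : ζ.re = 0 := by
    rw [him_eq] at hle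
    nlinarith [mul_self_nonneg ζ.re]
  rcases (abs_eq zero_le_one).1 him_eq with h | h
  · exact hI (Complex.ext (by simp [hre]) (by simp [h]))
  · exact hI' (Complex.ext (by simp [hre]) (by simp [h]))

theorem isPreconnected_re_pos_inter_horizontalStrip_inter_invertedStrip :
    IsPreconnected ({ζ : ℂ | 0 < ζ.re} ∩ (horizontalStrip ∩ invertedStrip)) := by
  -- At height `b` this set is the ray `re ζ > √(|b| - b²)`.
  let φ : ℝ × ℝ → ℂ := fun p => ⟨p.1 + √(|p.2| - p.2 ^ 2), p.2⟩
  have hφ : Continuous φ := equivRealProdCLM.symm.continuous.comp (by fun_prop : Continuous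
    fun p : ℝ × ℝ => (p.1 + √(|p.2| - p.2 ^ 2), p.2))
  have himage : {ζ : ℂ | 0 < ζ.re} ∩ (horizontalStrip ∩ invertedStrip) =
      φ '' Set.Ioi 0 ×ˢ Set.Ioo (-1) 1 := by
    ext ζ
    constructor
    · rintro ⟨hre : 0 < ζ.re, hS : |ζ.im| < 1, hV : |ζ.im| < normSq ζ⟩
      refine ⟨(ζ.re - √(|ζ.im| - ζ.im ^ 2), ζ.im), ⟨?_, abs_lt.1 hS⟩, by simp [φ]⟩
      refine sub_pos.2 ((Real.sqrt_lt' hre).2 ?_)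
      rw [normSq_apply] at hV
      linarith
    · rintro ⟨⟨r, b⟩, ⟨hr : 0 < r, hb⟩, rfl⟩
      have hre : 0 < r + √(|b| - b ^ 2) := by positivity
      refine ⟨hre, abs_lt.2 hb, ?_⟩
      change |b| < normSq ⟨r + √(|b| - b ^ 2), b⟩
      have := (Real.sqrt_lt' hre).1 (lt_add_of_pos_left _ hr)
      rw [normSq_mk]
      linarith
  rw [himage]
  exact (isPreconnected_Ioi.prod isPreconnected_Ioo).image φ hφ.continuousOn

theorem eqOn_horizontalStrip_inter_invertedStrip {f g : ℂ → ℂ}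
    (hf : DifferentiableOn ℂ f (horizontalStrip ∩ invertedStrip))
    (hg : DifferentiableOn ℂ g (horizontalStrip ∩ invertedStrip))
    (h : ∀ t : ℝ, t ≠ 0 → f t = g t) : Set.EqOn f g (horizontalStrip ∩ invertedStrip) := by
  have hright {f g : ℂ → ℂ} (hf : DifferentiableOn ℂ f (horizontalStrip ∩ invertedStrip))
      (hg : DifferentiableOn ℂ g (horizontalStrip ∩ invertedStrip))
      (h : ∀ t : ℝ, t ≠ 0 → f t = g t) :
      Set.EqOn f g ({ζ | 0 < ζ.re} ∩ (horizontalStrip ∩ invertedStrip)) :=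
    eqOn_of_forall_ofReal_eq ((isOpen_lt continuous_const continuous_re).inter
      (isOpen_horizontalStrip.inter isOpen_invertedStrip))
      isPreconnected_re_pos_inter_horizontalStrip_inter_invertedStrip (t₀ := 1)
      ⟨by simp, ofReal_mem_horizontalStrip 1, ofReal_mem_invertedStrip one_ne_zero⟩
      (hf.mono Set.inter_subset_right) (hg.mono Set.inter_subset_right)
      fun t ht => h t (by simpa using ht.1.ne')
  have hneg : Set.MapsTo (fun ζ : ℂ => -ζ) (horizontalStrip ∩ invertedStrip)
      (horizontalStrip ∩ invertedStrip) := fun _ =>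
    neg_mem_horizontalStrip_inter_invertedStrip
  intro ζ hζ
  rcases (re_ne_zero_of_mem_horizontalStrip_inter_invertedStrip hζ).lt_or_gt with hre | hre
  · have hleft := hright (hf.comp (differentiableOn_neg _) hneg)
      (hg.comp (differentiableOn_neg _) hneg)
      (fun t ht => by simpa using h (-t) (neg_ne_zero.2 ht))
    simpa using hleft ⟨by simpa using hre, hneg hζ⟩
  · exact hright hf hg h ⟨hre, hζ⟩

/-- The antiholomorphic inversion `ζ ↦ (conj ζ)⁻¹` of the plane acting on functions with weight `k`.
It fixes functions with `Θ (t⁻¹) = t ^ k * conj (Θ t)` on the real line. -/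
noncomputable def weightedReflection (k : ℕ) (Θ : ℂ → ℂ) (ζ : ℂ) : ℂ :=
  (ζ ^ k)⁻¹ * starRingEnd ℂ (Θ (starRingEnd ℂ ζ⁻¹))

theorem differentiableOn_weightedReflection {k : ℕ} {Θ : ℂ → ℂ}
    (hΘ : DifferentiableOn ℂ Θ horizontalStrip) :
    DifferentiableOn ℂ (weightedReflection k Θ) invertedStrip := by
  intro ζ hζ
  have hζ₀ := ne_zero_of_mem_invertedStrip hζ
  have hconj : DifferentiableAt ℂ (starRingEnd ℂ ∘ Θ ∘ starRingEnd ℂ) ζ⁻¹ := by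
    have := (hΘ.differentiableAt
      (isOpen_horizontalStrip.mem_nhds (conj_inv_mem_horizontalStrip hζ))).conj_conj
    rwa [conj_conj] at this
  exact ((differentiableAt_fun_id.pow k).fun_inv (pow_ne_zero k hζ₀)).mul
    (hconj.comp ζ (differentiableAt_inv hζ₀)) |>.differentiableWithinAt

theorem norm_weightedReflection_le {k : ℕ} {Θ : ℂ → ℂ} {M : ℝ}
    (hM : ∀ ζ ∈ horizontalStrip, ‖Θ ζ‖ ≤ M) {ζ : ℂ} (hζ : ζ ∈ invertedStrip) :
    ‖weightedReflection k Θ ζ‖ ≤ (‖ζ‖ ^ k)⁻¹ * M := by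
  rw [weightedReflection, norm_mul, norm_inv, norm_pow, norm_conj]
  gcongr
  exact hM _ (conj_inv_mem_horizontalStrip hζ)

theorem weightedReflection_ofReal {k : ℕ} {Θ : ℂ → ℂ} {t : ℝ} (ht : t ≠ 0)
    (hrefl : Θ (t : ℂ)⁻¹ = (t : ℂ) ^ k * starRingEnd ℂ (Θ t)) :
    weightedReflection k Θ t = Θ t := by
  rw [weightedReflection, ← ofReal_inv, conj_ofReal, ofReal_inv, hrefl, map_mul, map_pow,
    conj_ofReal, conj_conj, inv_mul_cancel_left₀ (pow_ne_zero k (ofReal_ne_zero.2 ht))]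

/-- The extension of a function on the strip `|Im ζ| < 1` to the plane by weighted reflection. -/
noncomputable def reflectionExtension (k : ℕ) (Θ : ℂ → ℂ) : ℂ → ℂ :=
  open scoped Classical in horizontalStrip.piecewise Θ (weightedReflection k Θ)

section Extension

variable {k : ℕ} {Θ : ℂ → ℂ}

theorem eqOn_reflectionExtension_horizontalStrip :
    Set.EqOn (reflectionExtension k Θ) Θ horizontalStrip := by
  classical exact Set.piecewise_eqOn _ _ _

theorem eqOn_reflectionExtension_invertedStrip (hΘ : DifferentiableOn ℂ Θ horizontalStrip)
    (hrefl : ∀ t : ℝ, t ≠ 0 → Θ (t : ℂ)⁻¹ = (t : ℂ) ^ k * starRingEnd ℂ (Θ t)) :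
    Set.EqOn (reflectionExtension k Θ) (weightedReflection k Θ) invertedStrip := by
  intro ζ hζ
  by_cases hS : ζ ∈ horizontalStrip
  · rw [eqOn_reflectionExtension_horizontalStrip hS]
    exact eqOn_horizontalStrip_inter_invertedStrip (hΘ.mono Set.inter_subset_left)
      ((differentiableOn_weightedReflection hΘ).mono Set.inter_subset_right)
      (fun t ht => (weightedReflection_ofReal ht (hrefl t ht)).symm) ⟨hS, hζ⟩
  · classical exact Set.piecewise_eq_of_notMem _ _ _ hS

theorem differentiableOn_reflectionExtension (hΘ : DifferentiableOn ℂ Θ horizontalStrip)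
    (hrefl : ∀ t : ℝ, t ≠ 0 → Θ (t : ℂ)⁻¹ = (t : ℂ) ^ k * starRingEnd ℂ (Θ t)) :
    DifferentiableOn ℂ (reflectionExtension k Θ) {I, -I}ᶜ := by
  refine DifferentiableOn.mono (t := horizontalStrip ∪ invertedStrip) ?_ fun ζ hζ => ?_
  · exact (hΘ.congr eqOn_reflectionExtension_horizontalStrip).union_of_isOpen
      ((differentiableOn_weightedReflection hΘ).congr
        (eqOn_reflectionExtension_invertedStrip hΘ hrefl))
      isOpen_horizontalStrip isOpen_invertedStrip
  · rw [Set.mem_compl_iff, Set.mem_insert_iff, Set.mem_singleton_iff, not_or] at hζ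
    exact or_iff_not_imp_left.2 (mem_invertedStrip_of_notMem_horizontalStrip hζ.1 hζ.2)

theorem norm_reflectionExtension_le {M : ℝ} (hΘ : DifferentiableOn ℂ Θ horizontalStrip)
    (hM : ∀ ζ ∈ horizontalStrip, ‖Θ ζ‖ ≤ M)
    (hrefl : ∀ t : ℝ, t ≠ 0 → Θ (t : ℂ)⁻¹ = (t : ℂ) ^ k * starRingEnd ℂ (Θ t)) {ζ : ℂ}
    (hI : ζ ≠ I) (hI' : ζ ≠ -I) : ‖reflectionExtension k Θ ζ‖ ≤ M := by
  by_cases hS : ζ ∈ horizontalStrip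
  · rw [eqOn_reflectionExtension_horizontalStrip hS]
    exact hM ζ hS
  · have hV := mem_invertedStrip_of_notMem_horizontalStrip hI hI' hS
    have hM₀ : 0 ≤ M := (norm_nonneg _).trans (hM _ (ofReal_mem_horizontalStrip 0))
    have hnorm : 1 ≤ ‖ζ‖ := (not_lt.1 hS).trans (abs_im_le_norm ζ)
    rw [eqOn_reflectionExtension_invertedStrip hΘ hrefl hV]
    exact (norm_weightedReflection_le hM hV).trans
      (mul_le_of_le_one_left hM₀ (inv_le_one_of_one_le₀ (one_le_pow₀ hnorm)))

theorem tendsto_reflectionExtension_atTop {M : ℝ} (hk : k ≠ 0)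
    (hΘ : DifferentiableOn ℂ Θ horizontalStrip) (hM : ∀ ζ ∈ horizontalStrip, ‖Θ ζ‖ ≤ M)
    (hrefl : ∀ t : ℝ, t ≠ 0 → Θ (t : ℂ)⁻¹ = (t : ℂ) ^ k * starRingEnd ℂ (Θ t)) :
    Tendsto (fun t : ℝ => reflectionExtension k Θ t) atTop (𝓝 0) := by
  have hlim : Tendsto (fun t : ℝ => (t ^ k)⁻¹ * M) atTop (𝓝 0) := by
    simpa using (tendsto_inv_atTop_zero.comp (tendsto_pow_atTop hk)).mul_const M
  refine squeeze_zero_norm' ?_ hlim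
  filter_upwards [eventually_gt_atTop 0] with t ht
  have hV := ofReal_mem_invertedStrip ht.ne'
  rw [eqOn_reflectionExtension_invertedStrip hΘ hrefl hV]
  simpa [abs_of_pos ht] using norm_weightedReflection_le hM hV

end Extension

theorem eqOn_zero_horizontalStrip_of_reflection {Θ : ℂ → ℂ} {M : ℝ} {k : ℕ} (hk : k ≠ 0)
    (hΘ : DifferentiableOn ℂ Θ horizontalStrip) (hM : ∀ ζ ∈ horizontalStrip, ‖Θ ζ‖ ≤ M)
    (hrefl : ∀ t : ℝ, t ≠ 0 → Θ (t : ℂ)⁻¹ = (t : ℂ) ^ k * starRingEnd ℂ (Θ t)) :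
    Set.EqOn Θ 0 horizontalStrip := by
  classical
  obtain ⟨c, hc⟩ : ∃ c, ∀ ζ ∉ ({I, -I} : Finset ℂ), reflectionExtension k Θ ζ = c := by
    refine exists_forall_notMem_eq_of_norm_le {I, -I} (M := M)
      (by simpa using differentiableOn_reflectionExtension hΘ hrefl) fun ζ hζ => ?_
    rw [Finset.mem_insert, Finset.mem_singleton, not_or] at hζ
    exact norm_reflectionExtension_le hΘ hM hrefl hζ.1 hζ.2
  have hnotMem {ζ : ℂ} (hζ : ζ ∈ horizontalStrip) : ζ ∉ ({I, -I} : Finset ℂ) := by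
    intro h
    rw [Finset.mem_insert, Finset.mem_singleton] at h
    rcases h with rfl | rfl <;> simp [horizontalStrip] at hζ
  have hc₀ : c = 0 := by
    refine tendsto_nhds_unique ?_ (tendsto_reflectionExtension_atTop hk hΘ hM hrefl)
    exact tendsto_const_nhds.congr fun t => (hc t (hnotMem (ofReal_mem_horizontalStrip t))).symm
  intro ζ hζ
  rw [← eqOn_reflectionExtension_horizontalStrip (k := k) (Θ := Θ) hζ, hc ζ (hnotMem hζ),
    hc₀, Pi.zero_apply]

end StripReflection

section SelfConvolution

open FourierTransform RealInnerProductSpace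

variable {n : ℕ} {q h : ℝ^n → ℂ} {w : ℝ^n → ℝ≥0}

theorem HasEntireExtensions.isEntireExtension_fconv_self (hT : HasEntireExtensions q)
    (hq : Integrable q volume) :
    IsEntireExtension (fconv q q) (fourierLaplace fun ξ => 𝓕 q ξ * 𝓕 q ξ) := by
  have hq' := hT.memLp_fourier hq
  have hext := hT.isEntireExtension_fourierLaplace hq (hq'.toLp (𝓕 q))
  rwa [fconv_congr_left (fourierInv_toLp_fourier_ae_eq hq hq'),
    fourierLaplace_mul_congr_left hq'.coeFn_toLp] at hext

theorem conj_fourierInv_neg (h : ℝ^n → ℂ) (x : ℝ^n) :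
    starRingEnd ℂ (𝓕⁻ h (-x)) = 𝓕⁻ (fun ξ => starRingEnd ℂ (h ξ)) x := by
  rw [Real.fourierInv_eq', Real.fourierInv_eq', ← integral_conj]
  refine integral_congr_ae (.of_forall fun ξ => ?_)
  simp only [smul_eq_mul, map_mul, ← Complex.exp_conj, Complex.conj_ofReal, Complex.conj_I,
    inner_neg_right]
  push_cast
  ring_nf

theorem conj_apply_neg_one_of_real_on_imaginary {g : ℂ → ℂ} (hg : Differentiable ℂ g)
    (hreal : ∀ t : ℝ, (g (t * Complex.I)).im = 0) : starRingEnd ℂ (g (-1)) = g 1 := by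
  let k : ℂ → ℂ := fun ζ => g (ζ * Complex.I)
  have hk : Differentiable ℂ k := hg.comp (by fun_prop)
  have hk' : Differentiable ℂ (starRingEnd ℂ ∘ k ∘ starRingEnd ℂ) := fun ζ => by
    have := (hk (starRingEnd ℂ ζ)).conj_conj
    rwa [Complex.conj_conj] at this
  have heq := congrFun (eq_of_forall_ofReal_eq hk' hk fun t => by
    simpa [k] using Complex.conj_eq_iff_im.2 (hreal t)) (-Complex.I)
  simpa [k] using heq

theorem im_eq_zero_of_fourierLaplace_im_eq_zero (hc : Continuous h) (hh : Integrable h volume)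
    (hdiff : Differentiable ℂ (fourierLaplace h))
    (hreal : ∀ y : ℝ^n, (fourierLaplace h (complexPoint 0 y)).im = 0) (ξ : ℝ^n) :
    (h ξ).im = 0 := by
  have hsymm (x : ℝ^n) : starRingEnd ℂ (𝓕⁻ h (-x)) = 𝓕⁻ h x := by
    have := conj_apply_neg_one_of_real_on_imaginary
      (g := fun ζ => fourierLaplace h (ζ • complexPoint x 0)) (hdiff.comp (by fun_prop)) fun t => by
        simpa [smul_complexPoint_zero_right] using hreal (t • x)
    rwa [neg_one_smul, one_smul, neg_complexPoint, neg_zero,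
      fourierLaplace_complexPoint_zero_right, fourierLaplace_complexPoint_zero_right] at this
  have hconj : (fun ξ => starRingEnd ℂ (h ξ)) =ᵐ[volume] h :=
    ae_eq_of_fourierInv_eq (Complex.conjLIE.integrable_comp_iff.2 hh) hh
      (funext fun x => (conj_fourierInv_neg h x).symm.trans (hsymm x))
  exact Complex.conj_eq_iff_im.1
    (congrFun ((Complex.continuous_conj.comp hc).ae_eq_iff_eq volume hc |>.1 hconj) ξ)

theorem forall_nonneg_of_isPreconnected_ne_zero {X : Type*} [TopologicalSpace X]
    [MeasurableSpace X] [OpensMeasurableSpace X] {μ : Measure X} [μ.IsOpenPosMeasure]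
    {u : X → ℝ} (hc : Continuous u) (hu : Integrable u μ) (hpre : IsPreconnected {x | u x ≠ 0})
    (hint : 0 ≤ ∫ x, u x ∂μ) (x : X) : 0 ≤ u x := by
  by_contra! hx
  have hneg : ∀ x', u x' ≤ 0 := by
    by_contra! ⟨x', hx'⟩
    obtain ⟨x₀, hx₀, hzero⟩ := hpre.intermediate_value (show u x ≠ 0 from hx.ne)
      (show u x' ≠ 0 from hx'.ne') hc.continuousOn ⟨hx.le, hx'.le⟩
    exact hx₀ hzero
  have hzero : ∫ x, -u x ∂μ = 0 :=
    le_antisymm (by rw [integral_neg]; linarith) (integral_nonneg fun x => neg_nonneg.2 (hneg x))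
  rw [integral_eq_zero_iff_of_nonneg (fun x => neg_nonneg.2 (hneg x)) hu.neg] at hzero
  exact hx.ne (neg_eq_zero.1
    (congrFun ((hc.neg.ae_eq_iff_eq μ continuous_const).1 hzero) x))

theorem ImageIsBergman.fourier_mul_self_eq (himage : ImageIsBergman q w)
    (hq : Integrable q volume) (hw : Measurable w)
    (hpos : ∀ y : ℝ^n, (fourierLaplace (fun ξ => 𝓕 q ξ * 𝓕 q ξ) (complexPoint 0 y)).im = 0 ∧
      0 ≤ (fourierLaplace (fun ξ => 𝓕 q ξ * 𝓕 q ξ) (complexPoint 0 y)).re)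
    (ξ : ℝ^n) : 𝓕 q ξ * 𝓕 q ξ = ((‖𝓕 q ξ‖ ^ 2 : ℝ) : ℂ) := by
  have hT := himage.hasEntireExtensions
  have hc : Continuous fun ξ => 𝓕 q ξ * 𝓕 q ξ :=
    (continuous_fourier_of_integrable hq).mul (continuous_fourier_of_integrable hq)
  have hi : Integrable (fun ξ => 𝓕 q ξ * 𝓕 q ξ) volume :=
    himage.integrable_mul_fourier hq (hT.memLp_fourier hq)
  have him := im_eq_zero_of_fourierLaplace_im_eq_zero hc hi (hT.isEntireExtension_fconv_self hq).1
    fun y => (hpos y).1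
  have hofReal (ξ : ℝ^n) : 𝓕 q ξ * 𝓕 q ξ = ((𝓕 q ξ * 𝓕 q ξ).re : ℂ) :=
    Complex.ext (by simp) (by simpa using him ξ)
  have hsupport : {ξ | (𝓕 q ξ * 𝓕 q ξ).re ≠ 0} = {ξ | 𝓕 q ξ ≠ 0} := by
    ext ξ
    rw [Set.mem_ofPred_eq, Set.mem_ofPred_eq, ← Complex.ofReal_ne_zero, ← hofReal,
      mul_self_ne_zero]
  have hint : 0 ≤ ∫ ξ, (𝓕 q ξ * 𝓕 q ξ).re := by
    have := (hpos 0).2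
    simp only [fourierLaplace, complexPoint_zero_zero, planeWave, map_zero, mul_zero,
      Complex.exp_zero, mul_one] at this
    exact this.trans_eq (integral_re hi).symm
  have hnonneg : 0 ≤ (𝓕 q ξ * 𝓕 q ξ).re :=
    forall_nonneg_of_isPreconnected_ne_zero (Complex.continuous_re.comp hc) hi.re
      (hsupport ▸ himage.isPreconnected_fourier_ne_zero hq hw) hint ξ
  rw [sq, ← norm_mul, hofReal, Complex.norm_real, Real.norm_of_nonneg hnonneg]

/-- The squared `L²` norm of `ξ ↦ h ξ * exp (-2π ξ·y)`. For `h = 𝓕 q` it controls the growth of the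
transforms `f * q` along the imaginary directions. -/
noncomputable def exponentialEnergy (h : ℝ^n → ℂ) (y : ℝ^n) : ℝ :=
  ∫ ξ, ‖h ξ * planeWave ξ (complexPoint 0 y)‖ ^ 2

theorem planeWave_two_smul (ξ y : ℝ^n) : planeWave ξ (complexPoint 0 ((2 : ℝ) • y)) =
    ((‖planeWave ξ (complexPoint 0 y)‖ ^ 2 : ℝ) : ℂ) := by
  rw [norm_planeWave, planeWave, complexDot_complexPoint, ← Real.exp_nat_mul, Complex.ofReal_exp]
  congr 1
  rw [inner_smul_right, inner_zero_right]
  push_cast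
  linear_combination (4 * Real.pi * ⟪ξ, y⟫ : ℂ) * Complex.I_mul_I

theorem fourierLaplace_norm_sq_two_smul (h : ℝ^n → ℂ) (y : ℝ^n) :
    fourierLaplace (fun ξ => ((‖h ξ‖ ^ 2 : ℝ) : ℂ)) (complexPoint 0 ((2 : ℝ) • y)) =
      exponentialEnergy h y := by
  simp only [fourierLaplace, exponentialEnergy, ← integral_complex_ofReal, planeWave_two_smul,
    norm_mul, mul_pow, Complex.ofReal_mul]

theorem norm_fourierLaplace_mul_le {φ : ℝ^n → ℂ} (hφ : MemLp φ 2 volume) (x : ℝ^n) {y : ℝ^n}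
    (hh : MemLp (fun ξ => h ξ * planeWave ξ (complexPoint 0 y)) 2 volume) :
    ‖fourierLaplace (fun ξ => φ ξ * h ξ) (complexPoint x y)‖ ≤
      √(∫ ξ, ‖φ ξ‖ ^ 2) * √(exponentialEnergy h y) := by
  calc ‖fourierLaplace (fun ξ => φ ξ * h ξ) (complexPoint x y)‖
      ≤ ∫ ξ, ‖φ ξ * h ξ * planeWave ξ (complexPoint x y)‖ := norm_integral_le_integral_norm _
    _ = ∫ ξ, ‖φ ξ‖ * ‖h ξ * planeWave ξ (complexPoint 0 y)‖ := by
        simp only [norm_mul, norm_planeWave, mul_assoc]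
    _ ≤ √(∫ ξ, ‖φ ξ‖ ^ 2) * √(exponentialEnergy h y) := by
        have := integral_mul_norm_le_Lp_mul_Lq Real.HolderConjugate.two_two
          (by simpa using hφ) (by simpa using hh)
        simpa only [Real.rpow_two, ← Real.sqrt_eq_rpow, exponentialEnergy] using this

theorem exponentialEnergy_neg_le {C : ℝ} (hC : ∀ᵐ ξ, ‖h (-ξ)‖ ≤ C * ‖h ξ‖) {y : ℝ^n}
    (hy : MemLp (fun ξ => h ξ * planeWave ξ (complexPoint 0 y)) 2 volume) :
    exponentialEnergy h (-y) ≤ C ^ 2 * exponentialEnergy h y := by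
  rw [exponentialEnergy, exponentialEnergy, ← integral_neg_eq_self, ← integral_const_mul]
  refine integral_mono_of_nonneg (.of_forall fun ξ => by positivity)
    (hy.norm.integrable_sq.const_mul _) ?_
  filter_upwards [hC] with ξ hξ
  rw [norm_mul, norm_mul, norm_planeWave (-ξ), norm_planeWave ξ, inner_neg_neg, ← mul_pow,
    ← mul_assoc]
  gcongr

theorem norm_planeWave_smul_sq_le (ξ y : ℝ^n) {b : ℝ} (hb : |b| ≤ 1) :
    ‖planeWave ξ (complexPoint 0 (b • y))‖ ^ 2 ≤
      ‖planeWave ξ (complexPoint 0 y)‖ ^ 2 + ‖planeWave ξ (complexPoint 0 (-y))‖ ^ 2 := by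
  simp only [norm_planeWave, ← Real.exp_nat_mul, inner_smul_right, inner_neg_right]
  have habs : |b * (2 * (2 * Real.pi * ⟪ξ, y⟫))| ≤ |2 * (2 * Real.pi * ⟪ξ, y⟫)| := by
    rw [abs_mul]
    exact mul_le_of_le_one_left (abs_nonneg _) hb
  calc Real.exp ((2 : ℕ) * -(2 * Real.pi * (b * ⟪ξ, y⟫)))
      = Real.exp (-(b * (2 * (2 * Real.pi * ⟪ξ, y⟫)))) := by push_cast; ring_nf
    _ ≤ Real.exp |2 * (2 * Real.pi * ⟪ξ, y⟫)| :=
        Real.exp_le_exp.2 ((neg_le_abs _).trans habs)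
    _ ≤ Real.exp (2 * (2 * Real.pi * ⟪ξ, y⟫)) + Real.exp (-(2 * (2 * Real.pi * ⟪ξ, y⟫))) :=
        Real.exp_abs_le _
    _ = _ := by push_cast; ring_nf

theorem exponentialEnergy_smul_le_add {y : ℝ^n} {b : ℝ} (hb : |b| ≤ 1)
    (hh : ∀ y, MemLp (fun ξ => h ξ * planeWave ξ (complexPoint 0 y)) 2 volume) :
    exponentialEnergy h (b • y) ≤ exponentialEnergy h y + exponentialEnergy h (-y) := by
  rw [exponentialEnergy, exponentialEnergy, exponentialEnergy,
    ← integral_add (hh _).norm.integrable_sq (hh _).norm.integrable_sq]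
  refine integral_mono (hh _).norm.integrable_sq
    ((hh _).norm.integrable_sq.add (hh _).norm.integrable_sq) fun ξ => ?_
  simp only [norm_mul, mul_pow, ← mul_add]
  gcongr
  exact norm_planeWave_smul_sq_le ξ y hb

theorem exponentialEnergy_smul_le {C : ℝ} (hC : ∀ᵐ ξ, ‖h (-ξ)‖ ≤ C * ‖h ξ‖)
    (hh : ∀ y, MemLp (fun ξ => h ξ * planeWave ξ (complexPoint 0 y)) 2 volume) (y : ℝ^n) {b : ℝ}
    (hb : |b| ≤ 1) : exponentialEnergy h (b • y) ≤ (1 + C ^ 2) * exponentialEnergy h y := by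
  linarith [exponentialEnergy_smul_le_add (y := y) hb hh, exponentialEnergy_neg_le hC (hh y)]

end SelfConvolution

section Uniqueness

open FourierTransform Complex

variable {n : ℕ}

/-- The correlation `ζ ↦ ∫ F(ζx) conj F(x) dx` over `ℝⁿ` of `F` with its complex dilates. -/
noncomputable def dilationCorrelation (F : ℂ^n → ℂ) (ζ : ℂ) : ℂ :=
  ∫ x : ℝ^n, F (ζ • complexPoint x 0) * starRingEnd ℂ (F (complexPoint x 0))

section DilationCorrelation

variable {F : ℂ^n → ℂ} {G : ℝ^n → ℝ}

theorem norm_dilationCorrelation_integrand_le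
    (hG : ∀ ζ ∈ horizontalStrip, ∀ x, ‖F (ζ • complexPoint x 0)‖ ≤ G x) {ζ : ℂ}
    (hζ : ζ ∈ horizontalStrip) (x : ℝ^n) :
    ‖F (ζ • complexPoint x 0) * starRingEnd ℂ (F (complexPoint x 0))‖ ≤
      ‖F (complexPoint x 0)‖ * G x := by
  rw [norm_mul, RCLike.norm_conj, mul_comm]
  gcongr
  exact hG ζ hζ x

theorem differentiableOn_dilationCorrelation (hF : Differentiable ℂ F)
    (hG : ∀ ζ ∈ horizontalStrip, ∀ x, ‖F (ζ • complexPoint x 0)‖ ≤ G x)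
    (hint : Integrable (fun x => ‖F (complexPoint x 0)‖ * G x) volume) :
    DifferentiableOn ℂ (dilationCorrelation F) horizontalStrip := by
  refine differentiableOn_integral_of_dominated isOpen_horizontalStrip (fun ζ _ => ?_) (fun x => ?_)
    (fun ζ => norm_dilationCorrelation_integrand_le hG) hint
  · have hreal := continuous_complexPoint_zero_right (n := n)
    exact ((hF.continuous.comp (hreal.const_smul ζ)).mul
      (continuous_conj.comp (hF.continuous.comp hreal))).aestronglyMeasurable
  · exact ((hF.comp (differentiable_id.smul_const _)).mul_const _).differentiableOn

theorem norm_dilationCorrelation_le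
    (hG : ∀ ζ ∈ horizontalStrip, ∀ x, ‖F (ζ • complexPoint x 0)‖ ≤ G x)
    (hint : Integrable (fun x => ‖F (complexPoint x 0)‖ * G x) volume) {ζ : ℂ}
    (hζ : ζ ∈ horizontalStrip) :
    ‖dilationCorrelation F ζ‖ ≤ ∫ x, ‖F (complexPoint x 0)‖ * G x :=
  norm_integral_le_of_norm_le hint (.of_forall (norm_dilationCorrelation_integrand_le hG hζ))

theorem dilationCorrelation_inv_ofReal (F : ℂ^n → ℂ) {t : ℝ} (ht : t ≠ 0) :
    dilationCorrelation F (t : ℂ)⁻¹ =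
      ((|t| ^ n : ℝ) : ℂ) * starRingEnd ℂ (dilationCorrelation F t) := by
  have hscale := Measure.integral_comp_smul volume (fun x : ℝ^n =>
    F ((t : ℂ)⁻¹ • complexPoint x 0) * starRingEnd ℂ (F (complexPoint x 0))) t
  have hpoint (x : ℝ^n) : complexPoint (t • x) 0 = (t : ℂ) • complexPoint x 0 := by
    rw [smul_complexPoint_zero_right, ofReal_re, ofReal_im, zero_smul]
  have hswap (x : ℝ^n) : F ((t : ℂ)⁻¹ • complexPoint (t • x) 0) *
      starRingEnd ℂ (F (complexPoint (t • x) 0)) =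
      starRingEnd ℂ (F ((t : ℂ) • complexPoint x 0) * starRingEnd ℂ (F (complexPoint x 0))) := by
    rw [hpoint, inv_smul_smul₀ (ofReal_ne_zero.2 ht), map_mul, conj_conj, mul_comm]
  simp only [hswap, integral_conj, finrank_euclideanSpace_fin, abs_inv, abs_pow] at hscale
  rw [dilationCorrelation, dilationCorrelation, hscale, real_smul, ← mul_assoc, ← ofReal_mul,
    mul_inv_cancel₀ (by positivity), ofReal_one, one_mul]

theorem dilationCorrelation_one (F : ℂ^n → ℂ) :
    dilationCorrelation F 1 = ((∫ x : ℝ^n, ‖F (complexPoint x 0)‖ ^ 2 : ℝ) : ℂ) := by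
  simp only [dilationCorrelation, one_smul, mul_conj', ← integral_complex_ofReal, ofReal_pow]

theorem dilationCorrelation_one_eq_zero (hn : n ≠ 0) (hF : Differentiable ℂ F)
    (hG : ∀ ζ ∈ horizontalStrip, ∀ x, ‖F (ζ • complexPoint x 0)‖ ≤ G x)
    (hint : Integrable (fun x => ‖F (complexPoint x 0)‖ * G x) volume) :
    dilationCorrelation F 1 = 0 := by
  -- Squaring turns the factor `|t| ^ n` of the reflection formula into `t ^ (2 * n)`.
  have hsq : Set.EqOn (fun ζ => dilationCorrelation F ζ ^ 2) 0 horizontalStrip := by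
    refine eqOn_zero_horizontalStrip_of_reflection (k := 2 * n) (by positivity)
      ((differentiableOn_dilationCorrelation hF hG hint).pow 2)
      (M := (∫ x, ‖F (complexPoint x 0)‖ * G x) ^ 2) (fun ζ hζ => ?_) fun t ht => ?_
    · rw [norm_pow]
      gcongr
      exact norm_dilationCorrelation_le hG hint hζ
    · rw [dilationCorrelation_inv_ofReal F ht, mul_pow, ← ofReal_pow, ← pow_mul, mul_comm n 2,
        pow_mul |t|, sq_abs, ← pow_mul, map_pow, ofReal_pow]
  exact pow_eq_zero_iff two_ne_zero |>.1 (hsq (by simpa using ofReal_mem_horizontalStrip 1))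

theorem eq_zero_of_integrable_mul_of_norm_smul_le (hn : n ≠ 0) (hF : Differentiable ℂ F)
    (hG : ∀ ζ ∈ horizontalStrip, ∀ x, ‖F (ζ • complexPoint x 0)‖ ≤ G x)
    (hint : Integrable (fun x => ‖F (complexPoint x 0)‖ * G x) volume) (x : ℝ^n) :
    F (complexPoint x 0) = 0 := by
  have hcont : Continuous fun x : ℝ^n => ‖F (complexPoint x 0)‖ ^ 2 :=
    (hF.continuous.comp continuous_complexPoint_zero_right).norm.pow 2
  have hsq : Integrable (fun x : ℝ^n => ‖F (complexPoint x 0)‖ ^ 2) volume := by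
    refine hint.mono' hcont.aestronglyMeasurable (.of_forall fun x => ?_)
    simpa [sq] using norm_dilationCorrelation_integrand_le hG
      (by simpa using ofReal_mem_horizontalStrip 1 : (1 : ℂ) ∈ horizontalStrip) x
  have hzero : ∫ x : ℝ^n, ‖F (complexPoint x 0)‖ ^ 2 = 0 := ofReal_eq_zero.1
    ((dilationCorrelation_one F).symm.trans (dilationCorrelation_one_eq_zero hn hF hG hint))
  rw [integral_eq_zero_iff_of_nonneg (fun x => by positivity) hsq] at hzero
  exact norm_eq_zero.1 (pow_eq_zero_iff two_ne_zero |>.1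
    (congrFun ((hcont.ae_eq_iff_eq volume continuous_zero).1 hzero) x))

end DilationCorrelation

namespace ImageIsBergman

variable {q : ℝ^n → ℂ} {w : ℝ^n → ℝ≥0}

theorem re_selfConvolution_eq_exponentialEnergy (himage : ImageIsBergman q w)
    (hq : Integrable q volume) (hw : Measurable w) {Q : ℂ^n → ℂ}
    (hQ : IsEntireExtension (fconv q q) Q)
    (hpos : ∀ y : ℝ^n, (Q (complexPoint 0 ((2 : ℝ) • y))).im = 0 ∧
      0 ≤ (Q (complexPoint 0 ((2 : ℝ) • y))).re) (y : ℝ^n) :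
    (Q (complexPoint 0 ((2 : ℝ) • y))).re = exponentialEnergy (𝓕 q) y := by
  obtain rfl := hQ.unique (himage.hasEntireExtensions.isEntireExtension_fconv_self hq)
  have hsq : (fun ξ => 𝓕 q ξ * 𝓕 q ξ) = fun ξ => ((‖𝓕 q ξ‖ ^ 2 : ℝ) : ℂ) :=
    funext <| himage.fourier_mul_self_eq hq hw fun y => by
      simpa only [smul_inv_smul₀ (two_ne_zero' ℝ)] using hpos ((2 : ℝ)⁻¹ • y)
  rw [hsq, fourierLaplace_norm_sq_two_smul, ofReal_re]

theorem exists_norm_smul_le_sqrt_exponentialEnergy (himage : ImageIsBergman q w)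
    (hq : Integrable q volume) (hw : Measurable w) (heven : ∀ y, w (-y) = w y) {F : ℂ^n → ℂ}
    (hF : F ∈ weightedBergman w) :
    ∃ A : ℝ, ∀ ζ ∈ horizontalStrip, ∀ x : ℝ^n,
      ‖F (ζ • complexPoint x 0)‖ ≤ A * √(exponentialEnergy (𝓕 q) x) := by
  have hmemLp (y : ℝ^n) : MemLp (fun ξ => 𝓕 q ξ * planeWave ξ (complexPoint 0 y)) 2 volume :=
    himage.hasEntireExtensions.memLp_fourier_mul_planeWave hq _
  obtain ⟨φ, hφ, rfl⟩ := himage.exists_eq_fourierLaplace hq hF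
  obtain ⟨C, hC⟩ := himage.exists_ae_norm_fourier_neg_le hq hw heven
  refine ⟨√(∫ ξ, ‖φ ξ‖ ^ 2) * √(1 + C ^ 2), fun ζ hζ x => ?_⟩
  rw [smul_complexPoint_zero_right, mul_assoc, ← Real.sqrt_mul (by positivity)]
  refine (norm_fourierLaplace_mul_le hφ _ (hmemLp _)).trans ?_
  gcongr
  exact exponentialEnergy_smul_le hC hmemLp x (le_of_lt hζ)

theorem fconv_ae_eq_zero (himage : ImageIsBergman q w) (hn : n ≠ 0) (hq : Integrable q volume)
    (hw : Measurable w) (heven : ∀ y, w (-y) = w y) {Q : ℂ^n → ℂ}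
    (hQ : IsEntireExtension (fconv q q) Q)
    (hpos : ∀ y : ℝ^n, (Q (complexPoint 0 ((2 : ℝ) • y))).im = 0 ∧
      0 ≤ (Q (complexPoint 0 ((2 : ℝ) • y))).re) {f : ℝ^n → ℂ} (hf : MemLp f 2 volume)
    (hfin : ∫⁻ y : ℝ^n, ‖fconv f q y‖ₑ *
      ENNReal.ofReal √(Q (complexPoint 0 ((2 : ℝ) • y))).re < ∞) :
    fconv f q =ᵐ[volume] 0 := by
  have henergy := himage.re_selfConvolution_eq_exponentialEnergy hq hw hQ hpos
  obtain ⟨F, hFB, hF⟩ := himage.1 f hf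
  obtain ⟨A, hA⟩ := himage.exists_norm_smul_le_sqrt_exponentialEnergy hq hw heven hFB
  simp only [← henergy] at hA
  have hcontF : Continuous fun x : ℝ^n => F (complexPoint x 0) :=
    hF.1.continuous.comp continuous_complexPoint_zero_right
  have hcontQ : Continuous fun y : ℝ^n => Q (complexPoint 0 ((2 : ℝ) • y)) :=
    hQ.1.continuous.comp (continuous_complexPoint.comp (by fun_prop :
      Continuous fun y : ℝ^n => ((0 : ℝ^n), (2 : ℝ) • y)))
  have hint : Integrable (fun y => ‖F (complexPoint y 0)‖ *
      √(Q (complexPoint 0 ((2 : ℝ) • y))).re) volume := by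
    refine ⟨(hcontF.norm.mul (continuous_re.comp hcontQ).sqrt).aestronglyMeasurable,
      lt_of_eq_of_lt (lintegral_congr_ae ?_) hfin⟩
    filter_upwards [hF.2] with y hy
    rw [enorm_mul, enorm_norm, hy, Real.enorm_of_nonneg (Real.sqrt_nonneg _)]
  have hzero := eq_zero_of_integrable_mul_of_norm_smul_le hn hF.1 hA
    (by simpa only [mul_left_comm] using hint.const_mul A)
  filter_upwards [hF.2] with x hx
  rw [← hx, hzero x, Pi.zero_apply]

end ImageIsBergman

end Uniqueness

theorem mainTheorem7_general (n : ℕ) (hn : 0 < n)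
    (q : EuclideanSpace ℝ (Fin n) → ℂ) (hq : Integrable q volume)
    (w : EuclideanSpace ℝ (Fin n) → ℝ≥0) (hw : Measurable w)
    (heven : ∀ y, w (-y) = w y)
    (himage : ImageIsBergman q w) :
    (∃ Q : EuclideanSpace ℂ (Fin n) → ℂ, IsEntireExtension (fconv q q) Q) ∧
    ∀ Q : EuclideanSpace ℂ (Fin n) → ℂ, IsEntireExtension (fconv q q) Q →
      (∀ y : EuclideanSpace ℝ (Fin n),
        (Q (complexPoint 0 ((2 : ℝ) • y))).im = 0 ∧
          0 ≤ (Q (complexPoint 0 ((2 : ℝ) • y))).re) →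
      (∀ f : EuclideanSpace ℝ (Fin n) → ℂ, MemLp f 2 volume →
        ∫⁻ y : EuclideanSpace ℝ (Fin n), ‖fconv f q y‖ₑ *
          ENNReal.ofReal (Real.sqrt (Q (complexPoint 0 ((2 : ℝ) • y))).re) < ∞ →
        fconv f q =ᵐ[volume] 0) ∧
      (TransformInjective q →
        ¬ ∃ f : EuclideanSpace ℝ (Fin n) → ℂ, MemLp f 2 volume ∧ ¬ (f =ᵐ[volume] 0) ∧
          ∫⁻ y : EuclideanSpace ℝ (Fin n), ‖fconv f q y‖ₑ *
            ENNReal.ofReal (Real.sqrt (Q (complexPoint 0 ((2 : ℝ) • y))).re) < ∞) := by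
  refine ⟨⟨_, himage.hasEntireExtensions.isEntireExtension_fconv_self hq⟩, fun Q hQ hpos => ?_⟩
  have hzero (f : EuclideanSpace ℝ (Fin n) → ℂ) (hf : MemLp f 2 volume)
      (hfin : ∫⁻ y, ‖fconv f q y‖ₑ *
        ENNReal.ofReal √(Q (complexPoint 0 ((2 : ℝ) • y))).re < ∞) : fconv f q =ᵐ[volume] 0 :=
    himage.fconv_ae_eq_zero hn.ne' hq hw heven hQ hpos hf hfin
  refine ⟨hzero, ?_⟩
  rintro hinj ⟨f, hf, hne, hfin⟩
  refine hne (hinj f 0 hf MemLp.zero' ?_)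
  rw [show fconv (0 : EuclideanSpace ℝ (Fin n) → ℂ) q = 0 from zero_convolution]
  exact hzero f hf hfin

theorem mainTheorem7 (n : ℕ) (hn : 0 < n)
    (q : EuclideanSpace ℝ (Fin n) → ℂ) (hq : Integrable q volume)
    (w : EuclideanSpace ℝ (Fin n) → ℝ≥0) (hw : Measurable w)
    (hrad : ∀ y y' : EuclideanSpace ℝ (Fin n), ‖y‖ = ‖y'‖ → w y = w y')
    (himage : ImageIsBergman q w) :
    (∃ Q : EuclideanSpace ℂ (Fin n) → ℂ, IsEntireExtension (fconv q q) Q) ∧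
    ∀ Q : EuclideanSpace ℂ (Fin n) → ℂ, IsEntireExtension (fconv q q) Q →
      (∀ y : EuclideanSpace ℝ (Fin n),
        (Q (complexPoint 0 ((2 : ℝ) • y))).im = 0 ∧
          0 ≤ (Q (complexPoint 0 ((2 : ℝ) • y))).re) →
      (∀ f : EuclideanSpace ℝ (Fin n) → ℂ, MemLp f 2 volume →
        ∫⁻ y : EuclideanSpace ℝ (Fin n), ‖fconv f q y‖ₑ *
          ENNReal.ofReal (Real.sqrt (Q (complexPoint 0 ((2 : ℝ) • y))).re) < ∞ →
        fconv f q =ᵐ[volume] 0) ∧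
      (TransformInjective q →
        ¬ ∃ f : EuclideanSpace ℝ (Fin n) → ℂ, MemLp f 2 volume ∧ ¬ (f =ᵐ[volume] 0) ∧
          ∫⁻ y : EuclideanSpace ℝ (Fin n), ‖fconv f q y‖ₑ *
            ENNReal.ofReal (Real.sqrt (Q (complexPoint 0 ((2 : ℝ) • y))).re) < ∞) :=
  mainTheorem7_general n hn q hq w hw (fun y => hrad _ _ (norm_neg y)) himage
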